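/- Let $1 \le k \le l < n-2$ be integers and let $s_i = (i,i+1)$, $1 \le i \le n-1$, be the simple transpositions of the symmetric group $\mathfrak{S}_n$. Let $v_{k,l} \in \mathfrak{S}_n$ be the product of the expression $$\mathbf{a} = s_l s_{l+1} s_{l+2}\; s_{l-1} s_l s_{l+1} \cdots s_k s_{k+1} s_{k+2},$$ the concatenation of the words $s_j s_{j+1} s_{j+2}$ for $j = l, l-1, \ldots, k$. Then $\mathbf{a}$ is a reduced expression for $v_{k,l}$, and the Kazhdan–Lusztig polynomial $P_{e,v_{k,l}}$ ($e$ the identity) lies in $\mathbb{Z}[q]$ and is the coefficient of $z^{l-k+1}$ in the power series expansion in $z$ of $$G_e(z) = \frac{-1 + q^2z^2 + q^3z^3}{(1 + qz + q^2z^2)(-1 + z + qz + qz^2 + q^2z^2 + q^2z^3 - q^4z^4)}.$$ Here the polynomials $P_{x,w}$ are those of Kazhdan and Lusztig: in the Hecke algebra of $\mathfrak{S}_n$ over $\mathbb{Q}(q^{1/2})$, with standard basis $(T_w)$, $T_sT_w = T_{sw}$ if $l(sw) > l(w)$ and $T_s^2 = (q-1)T_s + qT_e$, they form for each $w$ the unique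 family of polynomials in $q$ for which $C'_w = q^{-l(w)/2}\sum_{x \le w} P_{x,w}T_x$ is fixed by the involution $\sum_x \alpha_x T_x \mapsto \sum_x \overline{\alpha_x}\,(T_{x^{-1}})^{-1}$, $\overline{q^{1/2}} = q^{-1/2}$, while $P_{w,w} = 1$, $\deg P_{x,w} \le \frac12(l(w)-l(x)-1)$ for $x < w$ in the Bruhat order, and $P_{x,w} = 0$ for $x \not\le w$. -/

import Mathlib

namespace KazhdanLusztig

/-- The generator `s_i` of the symmetric group on `n` letters, `1 ≤ i < n`: the transposition of
the `i`-th and the `(i+1)`-st letter. The letters `1, …, n` are the elements of `Fin n` in order.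
(For other `i` the value is the identity; such `i` are not allowed in expressions.) -/
def simple (n i : ℕ) : Equiv.Perm (Fin n) :=
  if h : 1 ≤ i ∧ i < n then Equiv.swap ⟨i - 1, by omega⟩ ⟨i, h.2⟩ else 1

/-- A word in the indices `1, …, n - 1` of the generators. -/
def IsExpression (n : ℕ) (a : List ℕ) : Prop := ∀ i ∈ a, 1 ≤ i ∧ i < n

/-- The product `s_{i_1} ⋯ s_{i_r}` of an expression. -/
def wordProd (n : ℕ) (a : List ℕ) : Equiv.Perm (Fin n) := (a.map (simple n)).prod

/-- The length `l(w)`: the least `r` such that `w` is a product of `r` generators. -/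
noncomputable def len {n : ℕ} (w : Equiv.Perm (Fin n)) : ℕ :=
  sInf {r | ∃ a : List ℕ, IsExpression n a ∧ wordProd n a = w ∧ a.length = r}

/-- `a` is a reduced expression for `w`. -/
def IsReducedExpression {n : ℕ} (a : List ℕ) (w : Equiv.Perm (Fin n)) : Prop :=
  IsExpression n a ∧ wordProd n a = w ∧ a.length = len w

/-- The Bruhat–Chevalley order: `x ≤ w` iff there is a chain from `x` to `w` in which each element
is obtained from its predecessor by multiplication with a reflection (that is, a transposition)
that increases the length. -/
def BruhatLE {n : ℕ} : Equiv.Perm (Fin n) → Equiv.Perm (Fin n) → Prop :=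
  Relation.ReflTransGen fun u v => ∃ t : Equiv.Perm (Fin n), t.IsSwap ∧ v = u * t ∧ len u < len v

section Length

variable {n : ℕ}

theorem simple_eq {i : ℕ} (h : 1 ≤ i ∧ i < n) :
    ∃ a b : Fin n, (b : ℕ) = a + 1 ∧ (b : ℕ) = i ∧ simple n i = Equiv.swap a b :=
  ⟨⟨i - 1, by omega⟩, ⟨i, h.2⟩, by simp; omega, rfl, by rw [simple, dif_pos h]⟩

theorem simple_mul_self (i : ℕ) : simple n i * simple n i = 1 := by
  unfold simple
  split_ifs <;> simp

theorem simple_inv (i : ℕ) : (simple n i)⁻¹ = simple n i :=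
  inv_eq_of_mul_eq_one_left (simple_mul_self i)

theorem wordProd_cons (i : ℕ) (a : List ℕ) : wordProd n (i :: a) = simple n i * wordProd n a := by
  simp [wordProd]

theorem wordProd_concat (a : List ℕ) (i : ℕ) :
    wordProd n (a ++ [i]) = wordProd n a * simple n i := by
  simp [wordProd]

theorem wordProd_reverse (a : List ℕ) : wordProd n a.reverse = (wordProd n a)⁻¹ := by
  induction a with
  | nil => simp [wordProd]
  | cons i a ih => rw [List.reverse_cons, wordProd_concat, ih, wordProd_cons, mul_inv_rev, simple_inv]

/-- The set of inversions, an auxiliary notion. -/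
def invSet (w : Equiv.Perm (Fin n)) : Finset (Fin n × Fin n) :=
  Finset.univ.filter fun p => p.1 < p.2 ∧ w p.2 < w p.1

theorem mem_invSet (w : Equiv.Perm (Fin n)) (x y : Fin n) :
    (x, y) ∈ invSet w ↔ x < y ∧ w y < w x := by
  simp [invSet]

theorem card_invSet_mul_swap (w : Equiv.Perm (Fin n)) {a b : Fin n} (hab : (b : ℕ) = a + 1)
    (h : w a < w b) : (invSet (w * Equiv.swap a b)).card = (invSet w).card + 1 := by
  have hne : a ≠ b := by intro h; rw [h] at hab; omega
  have key : invSet (w * Equiv.swap a b) = insert (a, b)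
      ((invSet w).image (Prod.map (Equiv.swap a b) (Equiv.swap a b))) := by
    ext ⟨x, y⟩
    simp only [mem_invSet, Finset.mem_insert,
      Finset.mem_image, Prod.exists, Prod.map_apply, Prod.mk.injEq, Equiv.Perm.mul_apply]
    constructor
    · rintro ⟨h1, h2⟩
      by_cases hx : x = a ∧ y = b
      · exact Or.inl hx
      · refine Or.inr ⟨Equiv.swap a b x, Equiv.swap a b y, ⟨?_, h2⟩, by simp, by simp⟩
        rw [Equiv.swap_apply_def, Equiv.swap_apply_def]
        simp only [Fin.lt_def, Fin.ext_iff] at *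
        split_ifs <;> omega
    · rintro (⟨rfl, rfl⟩ | ⟨x', y', ⟨h1, h2⟩, rfl, rfl⟩)
      · refine ⟨by rw [Fin.lt_def]; omega, ?_⟩
        simpa using h
      · refine ⟨?_, by simpa using h2⟩
        have hx : ¬ (x' = a ∧ y' = b) := by
          rintro ⟨rfl, rfl⟩
          exact absurd h2 (not_lt.mpr h.le)
        clear h2 h
        rw [Equiv.swap_apply_def, Equiv.swap_apply_def]
        simp only [Fin.lt_def, Fin.ext_iff] at *
        split_ifs <;> omega
  rw [key, Finset.card_insert_of_notMem, Finset.card_image_of_injective]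
  · exact (Equiv.swap a b).injective.prodMap (Equiv.swap a b).injective
  · simp only [mem_invSet, Finset.mem_image, Prod.exists,
      Prod.map_apply, Prod.mk.injEq]
    rintro ⟨x, y, ⟨h1, h2⟩, hx, hy⟩
    have hx' : x = b := by rw [Equiv.swap_apply_eq_iff] at hx; simpa using hx
    have hy' : y = a := by rw [Equiv.swap_apply_eq_iff] at hy; simpa using hy
    subst hx' hy'
    rw [Fin.lt_def] at h1; omega

theorem card_invSet_mul_swap' (w : Equiv.Perm (Fin n)) {a b : Fin n} (hab : (b : ℕ) = a + 1)
    (h : w b < w a) : (invSet (w * Equiv.swap a b)).card + 1 = (invSet w).card := by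
  have := card_invSet_mul_swap (w * Equiv.swap a b) hab (by simpa using h)
  rw [mul_assoc, Equiv.swap_mul_self, mul_one] at this
  exact this.symm

theorem card_invSet_wordProd_le (a : List ℕ) (ha : IsExpression n a) :
    (invSet (wordProd n a)).card ≤ a.length := by
  induction a using List.reverseRecOn with
  | nil =>
    simp only [wordProd, List.map_nil, List.prod_nil, List.length_nil, Nat.le_zero,
      Finset.card_eq_zero, invSet, Finset.filter_eq_empty_iff]
    rintro ⟨x, y⟩ -
    simpa using fun h => le_of_lt h
  | append_singleton a i ih =>
    have ih' := ih (fun j hj => ha j (by simp [hj]))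
    obtain ⟨x, y, hxy, -, hs⟩ := simple_eq (ha i (by simp))
    rw [wordProd_concat, hs, List.length_append, List.length_singleton]
    rcases lt_trichotomy (wordProd n a x) (wordProd n a y) with h | h | h
    · rw [card_invSet_mul_swap _ hxy h]; omega
    · have := (wordProd n a).injective h
      rw [this] at hxy; omega
    · have := card_invSet_mul_swap' _ hxy h; omega

theorem exists_descent (w : Equiv.Perm (Fin n)) (hw : w ≠ 1) :
    ∃ a b : Fin n, (b : ℕ) = a + 1 ∧ w b < w a := by
  by_contra! hcon
  apply hw
  have hm : StrictMono w := by
    cases n with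
    | zero => exact fun x => x.elim0
    | succ m =>
      rw [Fin.strictMono_iff_lt_succ]
      intro i
      refine lt_of_le_of_ne (hcon _ _ (by simp)) ?_
      intro h
      have := w.injective h
      simp [Fin.ext_iff] at this
  ext x
  have : (hm.orderIsoOfSurjective w w.surjective) = OrderIso.refl _ := Subsingleton.elim _ _
  have h2 := congrArg (fun f => (f x : ℕ)) this
  simpa using h2

theorem exists_word (w : Equiv.Perm (Fin n)) :
    ∃ a : List ℕ, IsExpression n a ∧ wordProd n a = w ∧ a.length = (invSet w).card := by
  induction hk : (invSet w).card generalizing w with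
  | zero =>
    refine ⟨[], by simp [IsExpression], ?_, rfl⟩
    by_contra hw
    obtain ⟨a, b, hab, h⟩ := exists_descent w (fun h => hw (by simp [h, wordProd]))
    have := card_invSet_mul_swap' w hab h
    omega
  | succ k ih =>
    have hw : w ≠ 1 := by
      rintro rfl
      have := card_invSet_wordProd_le (n := n) [] (by simp [IsExpression])
      simp [wordProd] at this
      simp [this] at hk
    obtain ⟨a, b, hab, h⟩ := exists_descent w hw
    have h1 := card_invSet_mul_swap' w hab h
    obtain ⟨l, hl, hl1, hl2⟩ := ih (w * Equiv.swap a b) (by omega)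
    have hb : 1 ≤ (b : ℕ) ∧ (b : ℕ) < n := ⟨by omega, b.2⟩
    refine ⟨l ++ [(b : ℕ)], ?_, ?_, by simp [hl2]⟩
    · intro i hi
      rw [List.mem_append, List.mem_singleton] at hi
      rcases hi with hi | rfl
      · exact hl i hi
      · exact hb
    · have : simple n b = Equiv.swap a b := by
        rw [simple, dif_pos hb]
        congr 1
        ext; simp; omega
      rw [wordProd_concat, hl1, this, mul_assoc, Equiv.swap_mul_self, mul_one]

theorem exists_reduced (w : Equiv.Perm (Fin n)) : ∃ a : List ℕ, IsReducedExpression a w := by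
  obtain ⟨a, h1, h2, -⟩ := exists_word w
  exact Nat.sInf_mem (s := {r | ∃ a : List ℕ, IsExpression n a ∧ wordProd n a = w ∧ a.length = r})
    ⟨_, a, h1, h2, rfl⟩

theorem len_eq (w : Equiv.Perm (Fin n)) : len w = (invSet w).card := by
  apply le_antisymm
  · exact Nat.sInf_le (exists_word w)
  · obtain ⟨a, h1, h2, h3⟩ := exists_reduced w
    rw [← h3, ← h2]
    exact card_invSet_wordProd_le a h1

theorem len_wordProd_le {a : List ℕ} (ha : IsExpression n a) : len (wordProd n a) ≤ a.length :=
  Nat.sInf_le ⟨a, ha, rfl, rfl⟩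

theorem len_inv_le (w : Equiv.Perm (Fin n)) : len w⁻¹ ≤ len w := by
  obtain ⟨a, h1, h2, h3⟩ := exists_reduced w
  rw [← h3, ← h2, ← wordProd_reverse, ← List.length_reverse]
  exact len_wordProd_le fun i hi => h1 i (by simpa using hi)

theorem len_inv (w : Equiv.Perm (Fin n)) : len w⁻¹ = len w :=
  le_antisymm (len_inv_le w) (by simpa using len_inv_le w⁻¹)

theorem len_one : len (1 : Equiv.Perm (Fin n)) = 0 :=
  Nat.le_zero.mp (len_wordProd_le (n := n) (a := []) (by simp [IsExpression]))

theorem len_mul_swap (w : Equiv.Perm (Fin n)) {a b : Fin n} (hab : (b : ℕ) = a + 1) :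
    w a < w b ∧ len (w * Equiv.swap a b) = len w + 1 ∨
      w b < w a ∧ len (w * Equiv.swap a b) + 1 = len w := by
  simp only [len_eq]
  rcases lt_trichotomy (w a) (w b) with h | h | h
  · exact Or.inl ⟨h, card_invSet_mul_swap w hab h⟩
  · rw [w.injective h] at hab; omega
  · exact Or.inr ⟨h, card_invSet_mul_swap' w hab h⟩

theorem len_swap_mul (w : Equiv.Perm (Fin n)) {a b : Fin n} (hab : (b : ℕ) = a + 1) :
    w⁻¹ a < w⁻¹ b ∧ len (Equiv.swap a b * w) = len w + 1 ∨
      w⁻¹ b < w⁻¹ a ∧ len (Equiv.swap a b * w) + 1 = len w := by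
  have h : len (Equiv.swap a b * w) = len (w⁻¹ * Equiv.swap a b) := by
    rw [← len_inv, mul_inv_rev, Equiv.swap_inv]
  rw [h, ← len_inv w]
  exact len_mul_swap w⁻¹ hab

theorem len_simple_mul (w : Equiv.Perm (Fin n)) {i : ℕ} (hi : 1 ≤ i ∧ i < n) :
    len (simple n i * w) = len w + 1 ∨ len (simple n i * w) + 1 = len w := by
  obtain ⟨a, b, hab, -, hs⟩ := simple_eq hi
  rw [hs]
  exact (len_swap_mul w hab).imp And.right And.right

theorem len_mul_simple (w : Equiv.Perm (Fin n)) {i : ℕ} (hi : 1 ≤ i ∧ i < n) :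
    len (w * simple n i) = len w + 1 ∨ len (w * simple n i) + 1 = len w := by
  obtain ⟨a, b, hab, -, hs⟩ := simple_eq hi
  rw [hs]
  exact (len_mul_swap w hab).imp And.right And.right

/-- Left and right multiplication by generators affect the length independently, except if they
have the same effect on the permutation. -/
theorem simple_mul_simple_cases (w : Equiv.Perm (Fin n)) {i j : ℕ} (hi : 1 ≤ i ∧ i < n)
    (hj : 1 ≤ j ∧ j < n) : simple n i * w = w * simple n j ∨
      ((len w < len (simple n i * w) ↔
          len (w * simple n j) < len (simple n i * (w * simple n j))) ∧
        (len w < len (w * simple n j) ↔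
          len (simple n i * w) < len ((simple n i * w) * simple n j))) := by
  obtain ⟨a, b, hab, -, hs⟩ := simple_eq hi
  obtain ⟨c, d, hcd, -, ht⟩ := simple_eq hj
  rw [hs, ht]
  by_cases hcase : Equiv.swap a b * w = w * Equiv.swap c d
  · exact Or.inl hcase
  right
  have hL : ∀ v : Equiv.Perm (Fin n), len v < len (Equiv.swap a b * v) ↔ v⁻¹ a < v⁻¹ b := by
    intro v
    rcases len_swap_mul v hab with ⟨h1, h2⟩ | ⟨h1, h2⟩
    · exact ⟨fun _ => h1, fun _ => by omega⟩
    · exact ⟨fun _ => by omega, fun h => absurd h h1.asymm⟩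
  have hR : ∀ v : Equiv.Perm (Fin n), len v < len (v * Equiv.swap c d) ↔ v c < v d := by
    intro v
    rcases len_mul_swap v hcd with ⟨h1, h2⟩ | ⟨h1, h2⟩
    · exact ⟨fun _ => h1, fun _ => by omega⟩
    · exact ⟨fun _ => by omega, fun h => absurd h h1.asymm⟩
  have hswap : ∀ {p q : Fin n} (_ : (q : ℕ) = p + 1) (x y : Fin n), ¬ (x = p ∧ y = q) →
      ¬ (x = q ∧ y = p) → (x < y ↔ Equiv.swap p q x < Equiv.swap p q y) := by
    intro p q hpq x y h1 h2
    rw [Equiv.swap_apply_def, Equiv.swap_apply_def]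
    simp only [Fin.lt_def, Fin.ext_iff] at *
    split_ifs <;> omega
  have hconj1 : w * Equiv.swap c d = Equiv.swap (w c) (w d) * w :=
    Equiv.mul_swap_eq_swap_mul w c d
  rw [hL, hL, hR, hR]
  have hne1 : ¬ (w c = a ∧ w d = b) := by
    rintro ⟨h1, h2⟩
    exact hcase (by rw [hconj1, h1, h2])
  have hne2 : ¬ (w c = b ∧ w d = a) := by
    rintro ⟨h1, h2⟩
    exact hcase (by rw [hconj1, h1, h2, Equiv.swap_comm])
  constructor
  · rw [mul_inv_rev, Equiv.swap_inv]
    simp only [Equiv.Perm.mul_apply]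
    apply hswap hcd
    · rintro ⟨h1, h2⟩
      exact hne1 ⟨by simp [← h1], by simp [← h2]⟩
    · rintro ⟨h1, h2⟩
      exact hne2 ⟨by simp [← h2], by simp [← h1]⟩
  · simp only [Equiv.Perm.mul_apply]
    exact hswap hab _ _ hne1 hne2

end Length

section Hecke

variable {K : Type*} [Field K] {q : K} {n : ℕ}

/-- The underlying module: formal linear combinations of permutations. -/
abbrev FreeMod (K : Type*) [Field K] (n : ℕ) : Type _ := Equiv.Perm (Fin n) →₀ K

noncomputable instance : AddCommGroup (FreeMod K n) := Finsupp.instAddCommGroup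

/-- Left multiplication by `T_s`, `s = s_i`: `T_w ↦ T_{sw}` if `l(sw) > l(w)`, and
`T_w ↦ (q - 1) T_w + q T_{sw}` otherwise. -/
noncomputable def leftOp (q : K) (n i : ℕ) : Module.End K (FreeMod K n) :=
  Finsupp.linearCombination K fun w =>
    if len w < len (simple n i * w) then Finsupp.single (simple n i * w) 1
    else Finsupp.single w (q - 1) + Finsupp.single (simple n i * w) q

/-- Right multiplication by `T_s`, an auxiliary notion. -/
noncomputable def rightOp (q : K) (n i : ℕ) : Module.End K (FreeMod K n) :=
  Finsupp.linearCombination K fun w =>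
    if len w < len (w * simple n i) then Finsupp.single (w * simple n i) 1
    else Finsupp.single w (q - 1) + Finsupp.single (w * simple n i) q

/-- The Hecke algebra of the symmetric group on `n` letters with parameter `q` over the field `K`, realized in its
left regular representation, as the algebra of operators generated by the left multiplications
by the `T_s`. See `heckeBasis`, `T_one`, `T_simple_mul` and `T_simple_mul_self` for the basis `T_w` and
the defining relations. -/
noncomputable def heckeSubalgebra (q : K) (n : ℕ) :
    Subalgebra K (Module.End K (FreeMod K n)) :=
  Algebra.adjoin K {f | ∃ i, (1 ≤ i ∧ i < n) ∧ f = leftOp q n i}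

/-- The Hecke algebra as a type. -/
def Hecke (q : K) (n : ℕ) : Type _ := heckeSubalgebra q n

noncomputable instance : Ring (Hecke q n) :=
  Subalgebra.toRing (heckeSubalgebra q n)

noncomputable instance : Algebra K (Hecke q n) :=
  Subalgebra.algebra (heckeSubalgebra q n)

theorem leftOp_single (i : ℕ) (w : Equiv.Perm (Fin n)) (c : K) :
    leftOp q n i (Finsupp.single w c) = if len w < len (simple n i * w) then
      Finsupp.single (simple n i * w) c
    else Finsupp.single w (c * (q - 1)) + Finsupp.single (simple n i * w) (c * q) := by
  simp only [leftOp, Finsupp.linearCombination_single]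
  split_ifs
  · simp
  · rw [smul_add, Finsupp.smul_single, Finsupp.smul_single, smul_eq_mul, smul_eq_mul]

theorem rightOp_single (i : ℕ) (w : Equiv.Perm (Fin n)) (c : K) :
    rightOp q n i (Finsupp.single w c) = if len w < len (w * simple n i) then
      Finsupp.single (w * simple n i) c
    else Finsupp.single w (c * (q - 1)) + Finsupp.single (w * simple n i) (c * q) := by
  simp only [rightOp, Finsupp.linearCombination_single]
  split_ifs
  · simp
  · rw [smul_add, Finsupp.smul_single, Finsupp.smul_single, smul_eq_mul, smul_eq_mul]

theorem leftOp_rightOp_comm {i j : ℕ} (hi : 1 ≤ i ∧ i < n) (hj : 1 ≤ j ∧ j < n) :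
    Commute (leftOp q n i) (rightOp q n j) := by
  refine Finsupp.lhom_ext fun w c => ?_
  simp only [Module.End.mul_apply]
  have hL : ∀ v : Equiv.Perm (Fin n), simple n i * (simple n i * v) = v := fun v => by
    rw [← mul_assoc, simple_mul_self, one_mul]
  rcases simple_mul_simple_cases w hi hj with h | ⟨h1, h2⟩
  · simp only [leftOp_single, rightOp_single, ← h]
    split_ifs with h3
    · have e1 : simple n i * w * simple n j = w := by
        rw [h, mul_assoc, simple_mul_self, mul_one]
      simp only [leftOp_single, rightOp_single, hL, e1]
    · have e1 : simple n i * w * simple n j = w := by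
        rw [h, mul_assoc, simple_mul_self, mul_one]
      simp only [map_add, leftOp_single, rightOp_single, hL, e1, ← h]
  · simp only [leftOp_single _ w, rightOp_single _ w]
    by_cases hA : len w < len (simple n i * w) <;> by_cases hB : len w < len (w * simple n j)
    · rw [if_pos hA, if_pos hB, leftOp_single, rightOp_single, if_pos (h1.mp hA), if_pos (h2.mp hB),
        mul_assoc]
    · rw [if_pos hA, if_neg hB, map_add, leftOp_single, leftOp_single, rightOp_single,
        if_pos (h1.mp hA), if_pos hA, if_neg (fun h => hB (h2.mpr h)), mul_assoc]
    · rw [if_neg hA, if_pos hB, map_add, rightOp_single, rightOp_single, leftOp_single,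
        if_pos (h2.mp hB), if_pos hB, if_neg (fun h => hA (h1.mpr h)), mul_assoc]
    · rw [if_neg hA, if_neg hB, map_add, map_add, rightOp_single, rightOp_single, leftOp_single,
        leftOp_single, if_neg hB, if_neg (fun h => hB (h2.mpr h)), if_neg hA,
        if_neg (fun h => hA (h1.mpr h)), mul_assoc]
      have e : ∀ a b : K, c * a * b = c * b * a := fun a b => by ring
      rw [e q (q - 1)]
      abel

theorem hecke_comm_rightOp (h : Hecke q n) {j : ℕ} (hj : 1 ≤ j ∧ j < n) :
    Commute h.1 (rightOp q n j) := by
  obtain ⟨f, hf⟩ := h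
  induction hf using Algebra.adjoin_induction with
  | mem f hf =>
    obtain ⟨i, hi, rfl⟩ := hf
    exact leftOp_rightOp_comm hi hj
  | algebraMap r => exact Algebra.commutes r _
  | add f g _ _ hf hg => exact hf.add_left hg
  | mul f g _ _ hf hg => exact hf.mul_left hg

/-- The value of a Hecke algebra element at the vector of the identity permutation. -/
noncomputable def evalOne (q : K) (n : ℕ) : Hecke q n →ₗ[K] FreeMod K n :=
  (LinearMap.applyₗ (Finsupp.single (1 : Equiv.Perm (Fin n)) 1)).comp (heckeSubalgebra q n).val.toLinearMap

theorem evalOne_apply (h : Hecke q n) :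
    evalOne q n h = h.1 (Finsupp.single (1 : Equiv.Perm (Fin n)) 1) := rfl

theorem evalOne_injective : Function.Injective (evalOne q n) := by
  rw [injective_iff_map_eq_zero]
  intro h hh
  rw [evalOne_apply] at hh
  have key : ∀ (k : ℕ) (w : Equiv.Perm (Fin n)), len w = k →
      h.1 (Finsupp.single w 1) = 0 := by
    intro k
    induction k with
    | zero =>
      intro w hw
      obtain ⟨a, -, h2, h3⟩ := exists_reduced w
      rw [hw, List.length_eq_zero_iff] at h3
      subst h3
      rw [← h2]
      simpa [wordProd] using hh
    | succ k ih =>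
      intro w hw
      obtain ⟨a, h1, h2, h3⟩ := exists_reduced w
      obtain ⟨b, i, rfl⟩ : ∃ b i, a = b ++ [i] := by
        rcases List.eq_nil_or_concat a with rfl | ⟨b, i, rfl⟩
        · simp [hw] at h3
        · exact ⟨b, i, by simp⟩
      have hi := h1 i (by simp)
      have hb : len (wordProd n b) ≤ b.length := len_wordProd_le fun j hj => h1 j (by simp [hj])
      rw [wordProd_concat] at h2
      have h4 := len_mul_simple (wordProd n b) hi
      rw [h2] at h4
      simp only [List.length_append, List.length_singleton] at h3
      have e : rightOp q n i (Finsupp.single (wordProd n b) 1) = Finsupp.single w 1 := by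
        rw [rightOp_single, h2, if_pos (by omega)]
      have := congrArg (fun f => f (Finsupp.single (wordProd n b) 1)) (hecke_comm_rightOp h hi).eq
      simp only [Module.End.mul_apply] at this
      rw [e] at this
      rw [this, ih _ (by omega), map_zero]
  apply Subtype.ext
  exact Finsupp.lhom_ext' fun w => LinearMap.ext_ring (key _ w rfl)

/-- The generator `T_s` of the Hecke algebra, `s = s_i`. -/
noncomputable def TGen (q : K) {i : ℕ} (hi : 1 ≤ i ∧ i < n) : Hecke q n :=
  ⟨leftOp q n i, Algebra.subset_adjoin ⟨i, hi, rfl⟩⟩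

theorem evalOne_TGen_mul {i : ℕ} (hi : 1 ≤ i ∧ i < n) (h : Hecke q n) :
    evalOne q n (TGen q hi * h) = leftOp q n i (evalOne q n h) := rfl

theorem exists_evalOne (k : ℕ) (w : Equiv.Perm (Fin n)) (hw : len w = k) :
    ∃ h : Hecke q n, evalOne q n h = Finsupp.single w 1 := by
  induction k generalizing w with
  | zero =>
    obtain ⟨a, -, h2, h3⟩ := exists_reduced w
    rw [hw, List.length_eq_zero_iff] at h3
    subst h3
    exact ⟨1, by rw [← h2]; rfl⟩
  | succ k ih =>
    obtain ⟨a, h1, h2, h3⟩ := exists_reduced w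
    cases a with
    | nil => simp [hw] at h3
    | cons i b =>
      have hi := h1 i (by simp)
      have hb : len (wordProd n b) ≤ b.length := len_wordProd_le fun j hj => h1 j (by simp [hj])
      rw [wordProd_cons] at h2
      have h4 := len_simple_mul (wordProd n b) hi
      rw [h2] at h4
      simp only [List.length_cons] at h3
      obtain ⟨h, hh⟩ := ih (wordProd n b) (by omega)
      exact ⟨TGen q hi * h, by rw [evalOne_TGen_mul, hh, leftOp_single, h2, if_pos (by omega)]⟩

theorem evalOne_surjective : Function.Surjective (evalOne q n) := by
  rw [← LinearMap.range_eq_top, eq_top_iff, ← Finsupp.span_single_eq_top, Submodule.span_le]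
  rintro _ ⟨w, c, rfl⟩
  obtain ⟨h, hh⟩ := exists_evalOne (q := q) _ w rfl
  exact ⟨c • h, by rw [map_smul, hh, Finsupp.smul_single, smul_eq_mul, mul_one]⟩

/-- The standard basis of the Hecke algebra, indexed by the permutations. -/
noncomputable def heckeBasis (q : K) (n : ℕ) : Module.Basis (Equiv.Perm (Fin n)) K (Hecke q n) :=
  Module.Basis.ofRepr (LinearEquiv.ofBijective (evalOne q n) ⟨evalOne_injective, evalOne_surjective⟩)

/-- The standard basis element `T_w` of the Hecke algebra. -/
noncomputable def T (q : K) (w : Equiv.Perm (Fin n)) : Hecke q n := heckeBasis q n w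

theorem evalOne_T (w : Equiv.Perm (Fin n)) : evalOne q n (T q w) = Finsupp.single w 1 :=
  (heckeBasis q n).repr_self w

theorem T_one : T q (1 : Equiv.Perm (Fin n)) = 1 :=
  evalOne_injective (by rw [evalOne_T]; rfl)

theorem T_simple {i : ℕ} (hi : 1 ≤ i ∧ i < n) : T q (simple n i) = TGen q hi := by
  apply evalOne_injective
  rw [evalOne_T, ← mul_one (TGen q hi), ← T_one, evalOne_TGen_mul, evalOne_T, leftOp_single, mul_one,
    if_pos]
  have := len_simple_mul (1 : Equiv.Perm (Fin n)) hi
  rw [mul_one, len_one] at this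
  rw [len_one]
  omega

/-- `T_s T_w = T_{sw}` if `l(sw) > l(w)`. -/
theorem T_simple_mul {i : ℕ} (hi : 1 ≤ i ∧ i < n) (w : Equiv.Perm (Fin n))
    (h : len w < len (simple n i * w)) : T q (simple n i) * T q w = T q (simple n i * w) := by
  apply evalOne_injective
  rw [T_simple hi, evalOne_TGen_mul, evalOne_T, evalOne_T, leftOp_single, if_pos h]

/-- `T_s² = (q - 1) T_s + q T_e`. -/
theorem T_simple_mul_self {i : ℕ} (hi : 1 ≤ i ∧ i < n) :
    T q (simple n i) * T q (simple n i) = (q - 1) • T q (simple n i) + q • T q 1 := by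
  apply evalOne_injective
  have := len_simple_mul (1 : Equiv.Perm (Fin n)) hi
  rw [mul_one, len_one] at this
  rw [map_add, map_smul, map_smul, evalOne_T, evalOne_T]
  nth_rewrite 1 [T_simple hi]
  rw [evalOne_TGen_mul, evalOne_T, leftOp_single, simple_mul_self, if_neg (by rw [len_one]; omega)]
  simp

theorem isUnit_T (hq : q ≠ 0) (w : Equiv.Perm (Fin n)) : IsUnit (T q w) := by
  have hgen : ∀ {i : ℕ}, 1 ≤ i ∧ i < n → IsUnit (T q (simple n i)) := by
    intro i hi
    have h := T_simple_mul_self (q := q) hi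
    rw [T_one] at h
    have e1 : T q (simple n i) * (q⁻¹ • (T q (simple n i) - (q - 1) • 1)) = 1 := by
      rw [mul_smul_comm, mul_sub, h, mul_smul_comm, mul_one, add_sub_cancel_left, smul_smul,
        inv_mul_cancel₀ hq, one_smul]
    have e2 : (q⁻¹ • (T q (simple n i) - (q - 1) • 1)) * T q (simple n i) = 1 := by
      rw [smul_mul_assoc, sub_mul, h, smul_mul_assoc, one_mul, add_sub_cancel_left, smul_smul,
        inv_mul_cancel₀ hq, one_smul]
    exact ⟨⟨_, _, e1, e2⟩, rfl⟩
  induction hk : len w generalizing w with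
  | zero =>
    obtain ⟨a, -, h2, h3⟩ := exists_reduced w
    rw [hk, List.length_eq_zero_iff] at h3
    subst h3
    rw [← h2]
    simp [wordProd, T_one]
  | succ k ih =>
    obtain ⟨a, h1, h2, h3⟩ := exists_reduced w
    cases a with
    | nil => simp [hk] at h3
    | cons i b =>
      have hi := h1 i (by simp)
      have hb : len (wordProd n b) ≤ b.length := len_wordProd_le fun j hj => h1 j (by simp [hj])
      rw [wordProd_cons] at h2
      have h4 := len_simple_mul (wordProd n b) hi
      rw [h2] at h4
      simp only [List.length_cons] at h3
      rw [← h2, ← T_simple_mul hi _ (by rw [h2]; omega)]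
      exact (hgen hi).mul (ih _ (by omega))

end Hecke

/-- The coefficient field `ℚ(q^{1/2})`; its generator `RatFunc.X` is `q^{1/2}`. -/
abbrev CoeffField : Type := RatFunc ℚ

/-- The element `q^{1/2}`. -/
noncomputable def sqrtQ : CoeffField := RatFunc.X

/-- The element `q`. -/
noncomputable def q : CoeffField := sqrtQ ^ 2

theorem sqrtQ_ne_zero : sqrtQ ≠ 0 := RatFunc.X_ne_zero

theorem q_ne_zero : q ≠ 0 := pow_ne_zero 2 sqrtQ_ne_zero

theorem eval₂_inv_sqrtQ_injective :
    Function.Injective (Polynomial.eval₂RingHom (RatFunc.C (K := ℚ)) sqrtQ⁻¹) := by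
  have h : Transcendental ℚ (sqrtQ⁻¹ : CoeffField) := fun h =>
    RatFunc.transcendental_X (K := ℚ) (by convert h.inv using 1; exacts [Subsingleton.elim _ _, (inv_inv sqrtQ).symm])
  have e : (algebraMap ℚ CoeffField) = RatFunc.C := Subsingleton.elim _ _
  have h2 := transcendental_iff_injective.mp h
  intro a b hab
  apply h2
  simpa [Polynomial.aeval_def, e] using hab

/-- The involution of the coefficient field over `ℚ` with `q^{1/2} ↦ q^{-1/2}`. -/
noncomputable def bar : CoeffField →+* CoeffField :=
  RatFunc.liftRingHom (Polynomial.eval₂RingHom (RatFunc.C (K := ℚ)) sqrtQ⁻¹)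
    (nonZeroDivisors_le_comap_nonZeroDivisors_of_injective _ eval₂_inv_sqrtQ_injective)

theorem bar_sqrtQ : bar sqrtQ = sqrtQ⁻¹ := by
  simp [bar, sqrtQ]

section KL

variable {n : ℕ}

/-- The involution `ι(∑ α_w T_w) = ∑ bar(α_w) (T_{w⁻¹})⁻¹`. (The inverses exist by `isUnit_T`.) -/
noncomputable def iota (h : Hecke q n) : Hecke q n :=
  ∑ w : Equiv.Perm (Fin n), bar ((heckeBasis q n).repr h w) • Ring.inverse (T q w⁻¹)

open Classical in
/-- The element `q^{-l(w)/2} ∑_{x ≤ w} P_x T_x` for a family of polynomials `P_x` in `q`. -/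
noncomputable def klElement (w : Equiv.Perm (Fin n)) (P : Equiv.Perm (Fin n) → Polynomial ℚ) :
    Hecke q n :=
  (sqrtQ ^ len w)⁻¹ • ∑ x ∈ Finset.univ.filter fun x => BruhatLE x w,
    (P x).eval₂ RatFunc.C q • T q x

/-- `P` is the family `x ↦ P_{x,w}` of Kazhdan–Lusztig polynomials of `w`: the element
`C'_w = q^{-l(w)/2} ∑_{x ≤ w} P_{x,w} T_x` is fixed by `ι`, `P_{w,w} = 1`, the degree of `P_{x,w}` is
at most `(l(w) - l(x) - 1) / 2` for `x < w`, and `P_{x,w} = 0` if `x ≰ w`. -/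
structure IsKLFamily (w : Equiv.Perm (Fin n)) (P : Equiv.Perm (Fin n) → Polynomial ℚ) : Prop where
  iota_eq : iota (klElement w P) = klElement w P
  self_eq : P w = 1
  degree_le : ∀ x, BruhatLE x w → x ≠ w → 2 * (P x).natDegree + len x + 1 ≤ len w
  eq_zero : ∀ x, ¬ BruhatLE x w → P x = 0

end KL

/-- The word `l, l+1, l+2, l-1, l, l+1, …, k, k+1, k+2` of the `3 × (l - k + 1)` diamond. -/
def diamondWord (k l : ℕ) : List ℕ :=
  (List.range (l + 1 - k)).flatMap fun j => [l - j, l - j + 1, l - j + 2]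

section GeneratingFunction

open PowerSeries

/-- The numerator `-1 + q² z² + q³ z³`, where `q` is the polynomial variable and `z` the power
series variable. -/
noncomputable def genNum : PowerSeries (Polynomial ℤ) :=
  -1 + C Polynomial.X ^ 2 * X ^ 2 + C Polynomial.X ^ 3 * X ^ 3

/-- The denominator `(1 + qz + q² z²)(-1 + z + qz + qz² + q² z² + q² z³ - q⁴ z⁴)`. -/
noncomputable def genDen : PowerSeries (Polynomial ℤ) :=
  (1 + C Polynomial.X * X + C Polynomial.X ^ 2 * X ^ 2) *
    (-1 + X + C Polynomial.X * X + C Polynomial.X * X ^ 2 + C Polynomial.X ^ 2 * X ^ 2 +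
      C Polynomial.X ^ 2 * X ^ 3 - C Polynomial.X ^ 4 * X ^ 4)

/-- The generating function `G_e(z) = genNum / genDen`, expanded in powers of `z`. The constant
term of the denominator is the unit `-1`. -/
noncomputable def genFun : PowerSeries (Polynomial ℤ) := genNum * invOfUnit genDen (-1)

theorem genFun_mul_genDen : genFun * genDen = genNum := by
  rw [genFun, mul_assoc, invOfUnit_mul, mul_one]
  simp [genDen]

end GeneratingFunction

end KazhdanLusztig

/-! Deodhar's method. Since `T_x (1 + T_s)` equals `T_x + T_{xs}` or `q (T_x + T_{xs})`, according
as `xs` is longer or shorter than `x`, the product of the `1 + T_s` along a word expands in the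
standard basis with coefficients `maskSum`: sums over subwords (masks), each weighted by `q` to the
number of letters met at a descent. The involution multiplies this product by `q^{-r}`, `r` the
length of the word (`iota_genProd`), so after division by `q^{r/2}` it is fixed. If the word is
reduced and the mask sums obey the Kazhdan–Lusztig degree bound, they form a Kazhdan–Lusztig family
(`isKLFamily_maskSum`); it is the only one, because the involution is unitriangular for the length
up to powers of `q` (`IsKLFamily.unique`).

For the diamond word the degree bound rests on locality. A row of three letters moves only a window
of three positions and the untouched entry just before it, which is smaller than the entries of the
window; afterwards the window has moved one place to the left and its former last position is never
touched again. In the balance of `2d` plus length against the number of letters, a letter skipped at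
an ascent gains one, a letter skipped at a descent loses one, and a letter used is neutral. A row
can make a net loss only from a decreasing window, and then it loses only one and leaves a window
that is not decreasing (`coeff_maskSum_rows_bound`). From an increasing window every mask except the
full one makes a strict gain (`maskSum_rows_of_increasing`), which also shows that the word is
reduced.

For the coefficient at the identity, an entry left behind by the window must already be in its
place. So only the relative order in the window matters, and the mask sums satisfy a linear
recursion on the six orders of three entries (`maskSum_rows_eq_stateSum`). Eliminating five of the
six generating functions gives `G_e` (`stateGen_mul_genDen`). -/

namespace KazhdanLusztig

/-! ### One-line notation and descents -/

section Values

variable {n : ℕ}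

/-- The value of a permutation at a position, as a natural number; the identity outside `[0, n)`. -/
def val (x : Equiv.Perm (Fin n)) (p : ℕ) : ℕ := if h : p < n then x ⟨p, h⟩ else p

theorem val_of_lt (x : Equiv.Perm (Fin n)) {p : ℕ} (h : p < n) : val x p = x ⟨p, h⟩ := dif_pos h

theorem val_coe (x : Equiv.Perm (Fin n)) (p : Fin n) : val x p = x p := val_of_lt x p.2

theorem val_injective (x : Equiv.Perm (Fin n)) : Function.Injective (val x) := by
  intro p p' h
  unfold val at h
  split_ifs at h with h1 h2 h2
  · simpa using x.injective (Fin.ext h)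
  · have := (x ⟨p, h1⟩).2
    omega
  · have := (x ⟨p', h2⟩).2
    omega
  · exact h

theorem val_one (p : ℕ) : val (1 : Equiv.Perm (Fin n)) p = p := by
  simp [val]

theorem eq_one_of_val {x : Equiv.Perm (Fin n)} (h : ∀ p, val x p = p) : x = 1 :=
  Equiv.ext fun p => Fin.ext (by rw [← val_coe, h]; rfl)

theorem val_mul_simple (x : Equiv.Perm (Fin n)) {i : ℕ} (hi : 1 ≤ i ∧ i < n) (p : ℕ) :
    val (x * simple n i) p = if p + 1 = i then val x i else if p = i then val x (i - 1)
      else val x p := by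
  by_cases hp : p < n
  · rw [val_of_lt _ hp, simple, dif_pos hi, Equiv.Perm.mul_apply, Equiv.swap_apply_def]
    simp only [Fin.ext_iff]
    split_ifs <;> first | omega | skip
    · rw [val_of_lt _ hi.2]
    · rw [val_of_lt]
    · rw [val_of_lt]
  · rw [if_neg (by omega), if_neg (by omega), val, val, dif_neg hp, dif_neg hp]

theorem len_mul_simple_val (x : Equiv.Perm (Fin n)) {i : ℕ} (hi : 1 ≤ i ∧ i < n) :
    val x (i - 1) < val x i ∧ len (x * simple n i) = len x + 1 ∨
      val x i < val x (i - 1) ∧ len (x * simple n i) + 1 = len x := by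
  obtain ⟨a, b, hab, hb, hs⟩ := simple_eq hi
  have ha : i - 1 = a := by omega
  rw [hs, ha, ← hb, val_coe, val_coe]
  exact len_mul_swap x hab

theorem len_mul_simple_lt_iff (x : Equiv.Perm (Fin n)) {i : ℕ} (hi : 1 ≤ i ∧ i < n) :
    len (x * simple n i) < len x ↔ val x i < val x (i - 1) := by
  have := len_mul_simple_val x hi
  omega

end Values

/-! ### Reflections, length and the Bruhat order -/

section Bruhat

variable {n : ℕ}

/-- With `c = b - 1`, the transposition `(a b)` is `(c b)(a c)(c b)`. The middle factor raises the
length by induction on `b - a`. The outer factors change it by one each and cannot both lower it,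
for that would need `x b < x c < x a`. -/
theorem len_lt_len_mul_swap (x : Equiv.Perm (Fin n)) {a b : Fin n} (hab : a < b) (h : x a < x b) :
    len x < len (x * Equiv.swap a b) := by
  obtain ⟨d, hd⟩ : ∃ d : ℕ, (b : ℕ) = a + d + 1 := ⟨b - a - 1, by rw [Fin.lt_def] at hab; omega⟩
  induction d generalizing x b with
  | zero =>
    rcases len_mul_swap x (a := a) (b := b) (by omega) with h1 | h1
    · omega
    · exact absurd h h1.1.asymm
  | succ d ih =>
    obtain ⟨c, hc⟩ : ∃ c : Fin n, (b : ℕ) = c + 1 := ⟨⟨b - 1, by omega⟩, by simp; omega⟩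
    have hac : a ≠ c := by rintro rfl; omega
    have hbc : b ≠ c := by rintro rfl; omega
    have hne : a ≠ b := hab.ne
    have hy := ih (x * Equiv.swap c b) (b := c) (by rw [Fin.lt_def]; omega)
      (by simpa [Equiv.swap_apply_of_ne_of_ne hac hne] using h) (by omega)
    have hconj : x * Equiv.swap a b =
        x * Equiv.swap c b * Equiv.swap a c * Equiv.swap c b := by
      rw [mul_assoc, mul_assoc, ← mul_assoc (Equiv.swap c b),
        Equiv.swap_mul_swap_mul_swap hac hne, Equiv.swap_comm]
    have h1 := len_mul_swap x hc
    have h2 := len_mul_swap (x * Equiv.swap c b * Equiv.swap a c) hc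
    rw [← hconj] at h2
    have e1 : (x * Equiv.swap c b * Equiv.swap a c) c = x a := by
      simp [Equiv.swap_apply_of_ne_of_ne hac hne]
    have e2 : (x * Equiv.swap c b * Equiv.swap a c) b = x c := by
      simp [Equiv.swap_apply_of_ne_of_ne hne.symm hbc]
    rw [e1, e2] at h2
    rcases h1 with h1 | h1 <;> rcases h2 with h2 | h2
    · omega
    · omega
    · omega
    · exact absurd (h.trans h1.1) h2.1.asymm

theorem len_lt_len_mul_swap_iff (x : Equiv.Perm (Fin n)) {a b : Fin n} (hab : a < b) :
    len x < len (x * Equiv.swap a b) ↔ x a < x b := by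
  refine ⟨fun h => ?_, len_lt_len_mul_swap x hab⟩
  by_contra hcon
  have h1 : x b < x a := lt_of_le_of_ne (not_lt.mp hcon) fun e => hab.ne' (x.injective e)
  have := len_lt_len_mul_swap (x * Equiv.swap a b) hab (by simpa using h1)
  rw [mul_assoc, Equiv.swap_mul_self, mul_one] at this
  omega

theorem BruhatLE.len_le {x w : Equiv.Perm (Fin n)} (h : BruhatLE x w) : len x ≤ len w := by
  induction h with
  | refl => exact le_rfl
  | tail _ h ih =>
    obtain ⟨t, -, -, h⟩ := h
    omega

theorem bruhatLE_mul_simple (x : Equiv.Perm (Fin n)) {i : ℕ} (hi : 1 ≤ i ∧ i < n)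
    (h : len x < len (x * simple n i)) : BruhatLE x (x * simple n i) := by
  obtain ⟨a, b, hab, -, hs⟩ := simple_eq hi
  exact Relation.ReflTransGen.single ⟨simple n i,
    ⟨a, b, by rintro rfl; omega, hs⟩, rfl, h⟩

/-- Lifting property: right multiplication by a generator is compatible with the Bruhat order. -/
theorem BruhatLE.mul_simple {x w : Equiv.Perm (Fin n)} {i : ℕ} (hi : 1 ≤ i ∧ i < n)
    (hw : len w < len (w * simple n i)) (h : BruhatLE x w) :
    BruhatLE (x * simple n i) (w * simple n i) := by
  -- The disjunction needs no assumption on `w`, so it passes along every step of a chain.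
  suffices H : BruhatLE (x * simple n i) w ∨ BruhatLE (x * simple n i) (w * simple n i) from
    H.elim (fun H => H.trans (bruhatLE_mul_simple w hi hw)) id
  clear hw
  induction h with
  | refl => exact Or.inr Relation.ReflTransGen.refl
  | @tail u v hu huv ih =>
    rcases ih with ih | ih
    · exact Or.inl (ih.tail huv)
    obtain ⟨t, ⟨a, b, hne, rfl⟩, rfl, hlt⟩ := huv
    wlog hab : a < b generalizing a b
    · have := this b a hne.symm (by rwa [Equiv.swap_comm])
        (lt_of_le_of_ne (not_lt.mp hab) hne.symm)
      rwa [Equiv.swap_comm b a] at this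
    rw [len_lt_len_mul_swap_iff u hab] at hlt
    obtain ⟨c, d, hcd, -, hs⟩ := simple_eq hi
    rw [hs] at ih ⊢
    -- If the reflection is the generator itself, `us` is the next element of the chain. Otherwise
    -- its conjugate by the generator is a length-increasing reflection from `us`.
    by_cases hc : a = c ∧ b = d
    · rw [hc.1, hc.2]
      exact Or.inl ih
    have key : u * Equiv.swap a b * Equiv.swap c d = u * Equiv.swap c d *
        Equiv.swap (Equiv.swap c d a) (Equiv.swap c d b) := by
      rw [mul_assoc, mul_assoc, Equiv.mul_swap_eq_swap_mul (Equiv.swap c d)]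
      simp
    refine Or.inr (ih.tail ⟨_, ⟨_, _, (Equiv.swap c d).injective.ne hne, rfl⟩, key, ?_⟩)
    rw [key, len_lt_len_mul_swap_iff]
    · simpa using hlt
    · rw [Equiv.swap_apply_def, Equiv.swap_apply_def]
      simp only [Fin.lt_def, Fin.ext_iff] at *
      split_ifs <;> omega

end Bruhat

/-! ### Sums over masks -/

section MaskSum

open Polynomial

variable {n : ℕ}

open Classical in
/-- Deodhar's sum over the masks of an expression `a`: the coefficient of `T_y` in
`T_x ∏_{i ∈ a} (1 + T_{s_i})`. -/
noncomputable def maskSum : List ℕ → Equiv.Perm (Fin n) → Equiv.Perm (Fin n) → ℤ[X]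
  | [], x, y => if x = y then 1 else 0
  | i :: a, x, y => (if len (x * simple n i) < len x then X else 1) *
      (maskSum a x y + maskSum a (x * simple n i) y)

theorem maskSum_cons (i : ℕ) (a : List ℕ) (x y : Equiv.Perm (Fin n)) :
    maskSum (i :: a) x y = (if len (x * simple n i) < len x then X else 1) *
      (maskSum a x y + maskSum a (x * simple n i) y) := rfl

theorem coeff_maskSum_cons {i : ℕ} (hi : 1 ≤ i ∧ i < n) {a : List ℕ} {x y : Equiv.Perm (Fin n)}
    {d : ℕ} (h : (maskSum (i :: a) x y).coeff d ≠ 0) :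
    ∃ d' : ℕ, ((maskSum a x y).coeff d' ≠ 0 ∨ (maskSum a (x * simple n i) y).coeff d' ≠ 0) ∧
      (val x (i - 1) < val x i ∧ len (x * simple n i) = len x + 1 ∧ d = d' ∨
        val x i < val x (i - 1) ∧ len (x * simple n i) + 1 = len x ∧ d = d' + 1) := by
  have hor : ∀ p p' : ℤ, p + p' ≠ 0 → p ≠ 0 ∨ p' ≠ 0 := fun p p' h => by
    by_contra! hc
    simp [hc] at h
  rw [maskSum_cons] at h
  rcases len_mul_simple_val x hi with h1 | h1
  · rw [if_neg (by omega), one_mul, coeff_add] at h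
    exact ⟨d, hor _ _ h, Or.inl ⟨h1.1, h1.2, rfl⟩⟩
  · rw [if_pos (by omega)] at h
    cases d with
    | zero => simp at h
    | succ d =>
      rw [coeff_X_mul, coeff_add] at h
      exact ⟨d, hor _ _ h, Or.inr ⟨h1.1, h1.2, rfl⟩⟩

/-- The generator `s_i` moves only the 0-based positions `i - 1` and `i`, so no letter of the word
can repair the wrong entry at `p`. -/
theorem maskSum_eq_zero_of_val_ne {a : List ℕ} (ha : IsExpression n a) {p : ℕ}
    (hp : ∀ i ∈ a, i < p) {x : Equiv.Perm (Fin n)} (hx : val x p ≠ p) : maskSum a x 1 = 0 := by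
  induction a generalizing x with
  | nil =>
    refine if_neg ?_
    rintro rfl
    exact hx (val_one p)
  | cons i a ih =>
    have ih' := @ih (fun j hj => ha j (by simp [hj])) (fun j hj => hp j (by simp [hj]))
    have hi := hp i (by simp)
    rw [maskSum_cons, ih' hx, ih', add_zero, mul_zero]
    rwa [val_mul_simple x (ha i (by simp)), if_neg (by omega), if_neg (by omega)]

theorem coeff_maskSum_nonneg (a : List ℕ) (x y : Equiv.Perm (Fin n)) (d : ℕ) :
    0 ≤ (maskSum a x y).coeff d := by
  induction a generalizing x d with
  | nil =>
    unfold maskSum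
    split_ifs
    · rw [coeff_one]
      split_ifs <;> simp
    · simp
  | cons i a ih =>
    rw [maskSum_cons]
    split_ifs
    · cases d with
      | zero => simp
      | succ d =>
        rw [coeff_X_mul, coeff_add]
        exact add_nonneg (ih _ _) (ih _ _)
    · rw [one_mul, coeff_add]
      exact add_nonneg (ih _ _) (ih _ _)

/-- Mask sums recurse on the first letter, while the Bruhat order is compared by removing the last
one; this passes between the two. -/
theorem maskSum_concat_ne_zero {a : List ℕ} {i : ℕ} {x y : Equiv.Perm (Fin n)}
    (h : maskSum (a ++ [i]) x y ≠ 0) :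
    maskSum a x y ≠ 0 ∨ maskSum a x (y * simple n i) ≠ 0 := by
  induction a generalizing x with
  | nil =>
    rw [List.nil_append, maskSum_cons] at h
    by_contra! hc
    have e : x * simple n i = y ↔ x = y * simple n i := by
      constructor
      · rintro rfl
        rw [mul_assoc, simple_mul_self, mul_one]
      · rintro rfl
        rw [mul_assoc, simple_mul_self, mul_one]
    simp only [maskSum] at hc h
    simp only [e] at h
    rw [hc.1, hc.2] at h
    simp at h
  | cons j a ih =>
    rw [List.cons_append, maskSum_cons] at h
    rw [maskSum_cons, maskSum_cons]
    have hX : (if len (x * simple n j) < len x then X else 1 : ℤ[X]) ≠ 0 := left_ne_zero_of_mul h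
    have h' := right_ne_zero_of_mul h
    -- Nonnegative coefficients rule out cancellation.
    have hadd : ∀ z z' u : Equiv.Perm (Fin n), (maskSum a z u ≠ 0 ∨ maskSum a z' u ≠ 0) →
        maskSum a z u + maskSum a z' u ≠ 0 := by
      intro z z' u hor h0
      have hz : ∀ d, (maskSum a z u).coeff d = 0 ∧ (maskSum a z' u).coeff d = 0 := fun d => by
        have := congrArg (coeff · d) h0
        simp only [coeff_add, coeff_zero] at this
        have h1 := coeff_maskSum_nonneg a z u d
        have h2 := coeff_maskSum_nonneg a z' u d
        omega
      rcases hor with hor | hor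
      · exact hor (Polynomial.ext fun d => (hz d).1)
      · exact hor (Polynomial.ext fun d => (hz d).2)
    have : maskSum (a ++ [i]) x y ≠ 0 ∨ maskSum (a ++ [i]) (x * simple n j) y ≠ 0 := by
      by_contra! hc
      simp [hc] at h'
    rcases this with h1 | h1 <;> rcases ih h1 with h2 | h2
    · exact Or.inl (mul_ne_zero hX (hadd _ _ _ (Or.inl h2)))
    · exact Or.inr (mul_ne_zero hX (hadd _ _ _ (Or.inl h2)))
    · exact Or.inl (mul_ne_zero hX (hadd _ _ _ (Or.inr h2)))
    · exact Or.inr (mul_ne_zero hX (hadd _ _ _ (Or.inr h2)))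

theorem bruhatLE_of_maskSum_ne_zero {a : List ℕ} (ha : IsReducedExpression a (wordProd n a))
    {y : Equiv.Perm (Fin n)} (h : maskSum a 1 y ≠ 0) : BruhatLE y (wordProd n a) := by
  induction a using List.reverseRecOn generalizing y with
  | nil =>
    have : (1 : Equiv.Perm (Fin n)) = y := by
      by_contra hc
      exact h (if_neg hc)
    rw [← this]
    exact Relation.ReflTransGen.refl
  | append_singleton a i ih =>
    obtain ⟨h1, -, h3⟩ := ha
    have hi := h1 i (by simp)
    have ha' : IsExpression n a := fun j hj => h1 j (by simp [hj])
    have h4 := len_wordProd_le ha'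
    rw [wordProd_concat] at h3 ⊢
    rw [List.length_append, List.length_singleton] at h3
    have h5 := len_mul_simple (wordProd n a) hi
    have hred : IsReducedExpression a (wordProd n a) := ⟨ha', rfl, by omega⟩
    have hlt : len (wordProd n a) < len (wordProd n a * simple n i) := by omega
    rcases maskSum_concat_ne_zero h with h6 | h6
    · exact (ih hred h6).trans (bruhatLE_mul_simple _ hi hlt)
    · have := (ih hred h6).mul_simple hi hlt
      rwa [mul_assoc, simple_mul_self, mul_one] at this

end MaskSum

/-! ### The diamond word and the degree bound -/

section Diamond

open Polynomial

variable {n : ℕ}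

/-- The word of the `3 × m` diamond whose lowest index is `k`, by recursion on `m`. -/
def rows (k : ℕ) : ℕ → List ℕ
  | 0 => []
  | m + 1 => (k + m) :: (k + m + 1) :: (k + m + 2) :: rows k m

theorem diamondWord_eq_rows {k l : ℕ} (h : k ≤ l + 1) : diamondWord k l = rows k (l + 1 - k) := by
  obtain ⟨m, hm⟩ : ∃ m, m = l + 1 - k := ⟨_, rfl⟩
  induction m generalizing l with
  | zero => rw [diamondWord, ← hm]; rfl
  | succ m ih =>
    cases l with
    | zero =>
      obtain ⟨rfl, rfl⟩ : k = 0 ∧ m = 0 := by omega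
      rfl
    | succ l =>
      rw [← hm, rows, show m = l + 1 - k by omega, ← ih (by omega) (by omega), diamondWord,
        diamondWord, ← hm, List.range_succ_eq_map, List.flatMap_cons, List.flatMap_map]
      have e1 : k + (l + 1 - k) = l + 1 := by omega
      have e2 : m = l + 1 - k := by omega
      simp [e1, e2, Nat.succ_eq_add_one]

theorem rows_index {k m i : ℕ} (h : i ∈ rows k m) : k ≤ i ∧ i < k + m + 2 := by
  induction m with
  | zero => simp [rows] at h
  | succ m ih =>
    simp only [rows, List.mem_cons] at h
    rcases h with rfl | rfl | rfl | h
    · omega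
    · omega
    · omega
    · have := ih h
      omega

theorem isExpression_rows {k m : ℕ} (hk : 1 ≤ k) (hm : k + m + 1 < n) :
    IsExpression n (rows k m) := fun i hi => by
  have := rows_index hi
  omega

theorem length_rows (k m : ℕ) : (rows k m).length = 3 * m := by
  induction m with
  | zero => rfl
  | succ m ih => rw [rows, List.length_cons, List.length_cons, List.length_cons, ih]; omega

theorem le_val_of_fixes {x : Equiv.Perm (Fin n)} {w : ℕ} (h : ∀ p < w, val x p = p) {p : ℕ}
    (hp : w ≤ p) : w ≤ val x p := by
  by_contra! hc
  have := val_injective x (h _ hc)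
  omega

/-- The degree bound for the masks of a diamond, starting from a permutation that fixes all the
positions before the window `w, w + 1, w + 2`, `w + 1 = k + m`. -/
theorem coeff_maskSum_rows_bound {k m w : ℕ} (hk : 1 ≤ k) (hm : k + m + 1 < n) (hw : w + 1 = k + m)
    {x y : Equiv.Perm (Fin n)} (hx : ∀ p < w, val x p = p) {d : ℕ}
    (h : (maskSum (rows k m) x y).coeff d ≠ 0) :
    2 * d + len y ≤ 3 * m + len x +
      (if val x (w + 2) < val x (w + 1) ∧ val x (w + 1) < val x w then 1 else 0) := by
  induction m generalizing x w d with
  | zero =>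
    rw [rows, maskSum] at h
    split_ifs at h with hxy
    · rw [hxy]
      have hd : d = 0 := by
        by_contra hd
        exact h (by rw [coeff_one, if_neg hd])
      omega
    · simp at h
  | succ m ih =>
    -- From here the window is `w + 1, w + 2, w + 3`, position `w` holds the new smallest entry, and
    -- the next window is `w, w + 1, w + 2`.
    obtain ⟨w, rfl⟩ : ∃ u, w = u + 1 := ⟨w - 1, by omega⟩
    have hkm : k + m = w + 1 := by omega
    have i1 : 1 ≤ w + 1 ∧ w + 1 < n := by omega
    have i2 : 1 ≤ w + 2 ∧ w + 2 < n := by omega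
    have i3 : 1 ≤ w + 3 ∧ w + 3 < n := by omega
    have ih' := fun (z : Equiv.Perm (Fin n)) hz e he =>
      @ih w (by omega) (by omega) z hz e he
    clear ih
    have v1 := fun z : Equiv.Perm (Fin n) => val_mul_simple z i1
    have v2 := fun z : Equiv.Perm (Fin n) => val_mul_simple z i2
    have v3 := fun z : Equiv.Perm (Fin n) => val_mul_simple z i3
    have b0 : val x w = w := hx w (by omega)
    have b1 := le_val_of_fixes hx (p := w + 1) (by omega)
    have b2 := le_val_of_fixes hx (p := w + 2) (by omega)
    have b3 := le_val_of_fixes hx (p := w + 3) (by omega)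
    have bp : ∀ p < w, val x p = p := fun p hp => hx p (by omega)
    rw [rows, hkm] at h
    simp only [show w + 1 + 1 = w + 2 from rfl, show w + 1 + 2 = w + 3 from rfl] at h ⊢
    obtain ⟨d1, h1, hd1⟩ := coeff_maskSum_cons i1 h
    clear h
    -- Eight cases: skip or use each of the three letters. Each splits into ascents and descents,
    -- which the order of the three window entries decides.
    rcases h1 with h | h <;> (
      obtain ⟨d2, h2, hd2⟩ := coeff_maskSum_cons i2 h
      clear h
      rcases h2 with h | h <;> (
        obtain ⟨d3, h3, hd3⟩ := coeff_maskSum_cons i3 h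
        clear h
        rcases h3 with h | h <;> (
          have key := ih' _ (by
            intro p hp
            have := bp p hp
            first
            | exact this
            | (simp only [v1, v2, v3]
               split_ifs <;> omega)) _ h
          clear h ih'
          simp [v1, v2, v3, b0] at key hd1 hd2 hd3
          split_ifs at key ⊢ <;> omega)))

end Diamond

/-! ### Reducedness and the strict degree bound -/

section Diamond

open Polynomial

variable {n : ℕ}

/-- Using all three letters carries the small entry past the window, whose increasing pattern
reappears one place to the left, so the induction continues. Every other choice skips a letter at an
ascent with a net gain of at least one, and the next window is not decreasing, so the general bound
becomes strict. -/
theorem maskSum_rows_of_increasing {k m w : ℕ} (hk : 1 ≤ k) (hm : k + m + 1 < n)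
    (hw : w + 1 = k + m) {x : Equiv.Perm (Fin n)} (hx : ∀ p < w, val x p = p)
    (h1 : val x w < val x (w + 1)) (h2 : val x (w + 1) < val x (w + 2)) :
    len (x * wordProd n (rows k m)) = len x + 3 * m ∧
      maskSum (rows k m) x (x * wordProd n (rows k m)) = 1 ∧
      ∀ y ≠ x * wordProd n (rows k m), ∀ d, (maskSum (rows k m) x y).coeff d ≠ 0 →
        2 * d + len y + 1 ≤ 3 * m + len x := by
  induction m generalizing x w with
  | zero =>
    have e : x * wordProd n (rows k 0) = x := by simp [rows, wordProd]
    rw [e]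
    refine ⟨rfl, if_pos rfl, fun y hy d hd => ?_⟩
    rw [rows, maskSum, if_neg (Ne.symm hy)] at hd
    simp at hd
  | succ m ih =>
    obtain ⟨w, rfl⟩ : ∃ u, w = u + 1 := ⟨w - 1, by omega⟩
    have hkm : k + m = w + 1 := by omega
    have i1 : 1 ≤ w + 1 ∧ w + 1 < n := by omega
    have i2 : 1 ≤ w + 2 ∧ w + 2 < n := by omega
    have i3 : 1 ≤ w + 3 ∧ w + 3 < n := by omega
    have v1 := fun z : Equiv.Perm (Fin n) => val_mul_simple z i1
    have v2 := fun z : Equiv.Perm (Fin n) => val_mul_simple z i2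
    have v3 := fun z : Equiv.Perm (Fin n) => val_mul_simple z i3
    simp only [show w + 1 + 1 = w + 2 from rfl, show w + 1 + 2 = w + 3 from rfl] at h1 h2
    have b0 : val x w = w := hx w (by omega)
    have b1 := le_val_of_fixes hx (p := w + 1) (by omega)
    have b2 := le_val_of_fixes hx (p := w + 2) (by omega)
    have b3 := le_val_of_fixes hx (p := w + 3) (by omega)
    have bp : ∀ p < w, val x p = p := fun p hp => hx p (by omega)
    have l1 := len_mul_simple_val x i1
    have l2 := len_mul_simple_val (x * simple n (w + 1)) i2
    have l3 := len_mul_simple_val (x * simple n (w + 1) * simple n (w + 2)) i3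
    simp [v1, v2, b0] at l1 l2 l3
    have hword : x * wordProd n (rows k (m + 1)) = x * simple n (w + 1) * simple n (w + 2) *
        simple n (w + 3) * wordProd n (rows k m) := by
      rw [rows, hkm, wordProd_cons, wordProd_cons, wordProd_cons]
      simp only [mul_assoc]
    have hsum : ∀ y, maskSum (rows k (m + 1)) x y =
        maskSum ((w + 2) :: (w + 3) :: rows k m) x y +
        (maskSum ((w + 3) :: rows k m) (x * simple n (w + 1)) y +
        (maskSum (rows k m) (x * simple n (w + 1) * simple n (w + 2)) y +
        maskSum (rows k m) (x * simple n (w + 1) * simple n (w + 2) * simple n (w + 3)) y)) := by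
      intro y
      rw [rows, hkm, maskSum_cons, if_neg (by omega), one_mul]
      congr 1
      rw [show w + 1 + 1 = w + 2 from rfl, show w + 1 + 2 = w + 3 from rfl, maskSum_cons,
        if_neg (by omega), one_mul]
      congr 1
      rw [maskSum_cons, if_neg (by omega), one_mul]
    have bound := fun (y z : Equiv.Perm (Fin n)) hz e he =>
      @coeff_maskSum_rows_bound n k m w hk (by omega) (by omega) z y hz e he
    -- `t1`, `t2`, `t3` treat the masks whose first skipped letter is the first, second or third of
    -- the row.
    have t1 : ∀ y d, (maskSum ((w + 2) :: (w + 3) :: rows k m) x y).coeff d ≠ 0 →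
        2 * d + len y + 1 ≤ 3 * (m + 1) + len x := by
      intro y d h
      obtain ⟨d2, h2, hd2⟩ := coeff_maskSum_cons i2 h
      clear h
      rcases h2 with h | h <;> (
        obtain ⟨d3, h3, hd3⟩ := coeff_maskSum_cons i3 h
        clear h
        rcases h3 with h | h <;> (
          have key := bound y _ (by
            intro p hp
            have := bp p hp
            first
            | exact this
            | (simp only [v2, v3]
               split_ifs <;> omega)) _ h
          clear h bound ih
          simp [v2, v3] at key hd2 hd3
          split_ifs at key <;> omega))
    have t2 : ∀ y d, (maskSum ((w + 3) :: rows k m) (x * simple n (w + 1)) y).coeff d ≠ 0 →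
        2 * d + len y + 1 ≤ 3 * (m + 1) + len x := by
      intro y d h
      obtain ⟨d3, h3, hd3⟩ := coeff_maskSum_cons i3 h
      clear h
      rcases h3 with h | h <;> (
        have key := bound y _ (by
          intro p hp
          have := bp p hp
          simp only [v1, v3]
          split_ifs <;> omega) _ h
        clear h bound ih
        simp [v1, v3, b0] at key hd3
        split_ifs at key <;> omega)
    have t3 : ∀ y d, (maskSum (rows k m)
        (x * simple n (w + 1) * simple n (w + 2)) y).coeff d ≠ 0 →
        2 * d + len y + 1 ≤ 3 * (m + 1) + len x := by
      intro y d h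
      have key := bound y _ (by
        intro p hp
        have := bp p hp
        simp only [v1, v2]
        split_ifs <;> omega) _ h
      clear h bound ih
      simp [v1, v2, b0] at key
      split_ifs at key <;> omega
    obtain ⟨g1, g2, g3⟩ := @ih w (by omega) (by omega)
      (x * simple n (w + 1) * simple n (w + 2) * simple n (w + 3)) (by
        intro p hp
        have := bp p hp
        simp only [v1, v2, v3]
        split_ifs <;> omega)
      (by simp [v1, v2, v3]; omega) (by simp [v1, v2, v3]; omega)
    rw [hword]
    refine ⟨by omega, ?_, fun y hy d hd => ?_⟩
    -- At the full product the length already equals the right-hand side, so the strict bound leaves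
    -- no coefficient.
    · have hzero : ∀ p : ℤ[X], (∀ d, p.coeff d ≠ 0 → 2 * d +
          len (x * simple n (w + 1) * simple n (w + 2) * simple n (w + 3) *
            wordProd n (rows k m)) + 1 ≤ 3 * (m + 1) + len x) → p = 0 := by
        intro p hp
        ext d
        by_contra hd
        have := hp d hd
        omega
      rw [hsum, g2, hzero _ (t1 _), hzero _ (t2 _), hzero _ (t3 _)]
      simp
    · have : ∀ p p' : ℤ, p + p' ≠ 0 → p ≠ 0 ∨ p' ≠ 0 := fun p p' h => by
        by_contra! hc
        simp [hc] at h
      rw [hsum, coeff_add, coeff_add, coeff_add] at hd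
      rcases this _ _ hd with hd | hd
      · exact t1 y d hd
      rcases this _ _ hd with hd | hd
      · exact t2 y d hd
      rcases this _ _ hd with hd | hd
      · exact t3 y d hd
      have := g3 y hy d hd
      omega

end Diamond

/-! ### The transfer matrix and the generating function -/

section Transfer

open Polynomial

variable {n : ℕ}

/-- One row of the transfer matrix on window states: a new smallest entry is put in front of the
window `a, b, c`, the three generators act, and the last entry has to be the largest one. -/
noncomputable def stateStep (f : ℕ → ℕ → ℕ → ℤ[X]) (a b c : ℕ) : ℤ[X] :=
  let drop (t₀ t₁ t₂ t₃ : ℕ) : ℤ[X] := if t₃ = 3 then f t₀ t₁ t₂ else 0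
  let third (t₀ t₁ t₂ t₃ : ℕ) : ℤ[X] :=
    (if t₃ < t₂ then X else 1) * (drop t₀ t₁ t₂ t₃ + drop t₀ t₁ t₃ t₂)
  let second (t₀ t₁ t₂ t₃ : ℕ) : ℤ[X] :=
    (if t₂ < t₁ then X else 1) * (third t₀ t₁ t₂ t₃ + third t₀ t₂ t₁ t₃)
  second 0 (a + 1) (b + 1) (c + 1) + second (a + 1) 0 (b + 1) (c + 1)

/-- The sum over the masks of `m` rows that bring the window state `a, b, c` to the identity. -/
noncomputable def stateSum : ℕ → ℕ → ℕ → ℕ → ℤ[X]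
  | 0 => fun a b c => if a = 0 ∧ b = 1 ∧ c = 2 then 1 else 0
  | m + 1 => stateStep (stateSum m)

theorem maskSum_rows_eq_stateSum {k m w : ℕ} (hk : 1 ≤ k) (hm : k + m + 1 < n)
    (hw : w + 1 = k + m) {x : Equiv.Perm (Fin n)} {a b c : ℕ}
    (hx : ∀ p, p < w ∨ w + 2 < p → val x p = p)
    (ha : val x w = w + a) (hb : val x (w + 1) = w + b) (hc : val x (w + 2) = w + c) :
    maskSum (rows k m) x 1 = stateSum m a b c := by
  induction m generalizing x w a b c with
  | zero =>
    rw [rows, maskSum, stateSum]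
    refine if_congr ⟨?_, fun h => eq_one_of_val fun p => ?_⟩ rfl rfl
    · rintro rfl
      rw [val_one] at ha hb hc
      omega
    · by_cases hp : p < w ∨ w + 2 < p
      · exact hx p hp
      · obtain rfl | rfl | rfl : p = w ∨ p = w + 1 ∨ p = w + 2 := by omega
        all_goals omega
  | succ m ih =>
    obtain ⟨w, rfl⟩ : ∃ u, w = u + 1 := ⟨w - 1, by omega⟩
    have hkm : k + m = w + 1 := by omega
    have i1 : 1 ≤ w + 1 ∧ w + 1 < n := by omega
    have i2 : 1 ≤ w + 2 ∧ w + 2 < n := by omega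
    have i3 : 1 ≤ w + 3 ∧ w + 3 < n := by omega
    have v1 := fun z : Equiv.Perm (Fin n) => val_mul_simple z i1
    have v2 := fun z : Equiv.Perm (Fin n) => val_mul_simple z i2
    have v3 := fun z : Equiv.Perm (Fin n) => val_mul_simple z i3
    simp only [show w + 1 + 1 = w + 2 from rfl, show w + 1 + 2 = w + 3 from rfl] at hb hc
    rw [rows, hkm]
    simp only [show w + 1 + 1 = w + 2 from rfl, show w + 1 + 2 = w + 3 from rfl]
    -- The remaining rows do not reach position `w + 3`, so a mask leading to the identity needs the
    -- right entry there.
    have hdrop : ∀ (z : Equiv.Perm (Fin n)) (t₀ t₁ t₂ t₃ : ℕ),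
        (∀ p, p < w ∨ w + 3 < p → val z p = p) → val z w = w + t₀ → val z (w + 1) = w + t₁ →
        val z (w + 2) = w + t₂ → val z (w + 3) = w + t₃ →
        maskSum (rows k m) z 1 = if t₃ = 3 then stateSum m t₀ t₁ t₂ else 0 := by
      intro z t₀ t₁ t₂ t₃ hz h0 h1 h2 h3
      split_ifs with h
      · refine ih (by omega) (by omega) (fun p hp => ?_) h0 h1 h2
        by_cases hp3 : p = w + 3
        · rw [hp3, h3, h]
        · exact hz p (by omega)
      · refine maskSum_eq_zero_of_val_ne (isExpression_rows hk (by omega)) (p := w + 3)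
          (fun i hi => ?_) (by omega)
        have := rows_index hi
        omega
    have hthird : ∀ (z : Equiv.Perm (Fin n)) (t₀ t₁ t₂ t₃ : ℕ),
        (∀ p, p < w ∨ w + 3 < p → val z p = p) → val z w = w + t₀ → val z (w + 1) = w + t₁ →
        val z (w + 2) = w + t₂ → val z (w + 3) = w + t₃ →
        maskSum ((w + 3) :: rows k m) z 1 = (if t₃ < t₂ then X else 1) *
          ((if t₃ = 3 then stateSum m t₀ t₁ t₂ else 0) +
            (if t₂ = 3 then stateSum m t₀ t₁ t₃ else 0)) := by
      intro z t₀ t₁ t₂ t₃ hz h0 h1 h2 h3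
      rw [maskSum_cons, hdrop z t₀ t₁ t₂ t₃ hz h0 h1 h2 h3, hdrop _ t₀ t₁ t₃ t₂]
      · congr 1
        refine if_congr ?_ rfl rfl
        rw [len_mul_simple_lt_iff z i3, show w + 3 - 1 = w + 2 from rfl]
        omega
      · intro p hp
        have := hz p hp
        rw [v3]
        split_ifs <;> omega
      all_goals simpa [v3]
    have hsecond : ∀ (z : Equiv.Perm (Fin n)) (t₀ t₁ t₂ t₃ : ℕ),
        (∀ p, p < w ∨ w + 3 < p → val z p = p) → val z w = w + t₀ → val z (w + 1) = w + t₁ →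
        val z (w + 2) = w + t₂ → val z (w + 3) = w + t₃ →
        maskSum ((w + 2) :: (w + 3) :: rows k m) z 1 = (if t₂ < t₁ then X else 1) *
          ((if t₃ < t₂ then X else 1) * ((if t₃ = 3 then stateSum m t₀ t₁ t₂ else 0) +
            (if t₂ = 3 then stateSum m t₀ t₁ t₃ else 0)) +
          (if t₃ < t₁ then X else 1) * ((if t₃ = 3 then stateSum m t₀ t₂ t₁ else 0) +
            (if t₁ = 3 then stateSum m t₀ t₂ t₃ else 0))) := by
      intro z t₀ t₁ t₂ t₃ hz h0 h1 h2 h3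
      rw [maskSum_cons, hthird z t₀ t₁ t₂ t₃ hz h0 h1 h2 h3, hthird _ t₀ t₂ t₁ t₃]
      · congr 1
        refine if_congr ?_ rfl rfl
        rw [len_mul_simple_lt_iff z i2, show w + 2 - 1 = w + 1 from rfl]
        omega
      · intro p hp
        have := hz p hp
        rw [v2]
        split_ifs <;> omega
      all_goals simpa [v2]
    have h0 : val x w = w := hx w (by omega)
    have hout : ∀ p, p < w ∨ w + 3 < p → val x p = p := fun p hp => hx p (by omega)
    -- The first letter meets the smallest entry and is never at a descent, so it has no factor `X`.
    -- Entries are now measured from `w` rather than `w + 1`, hence the shifts by one.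
    rw [maskSum_cons, if_neg, one_mul, hsecond x 0 (a + 1) (b + 1) (c + 1) hout,
      hsecond _ (a + 1) 0 (b + 1) (c + 1)]
    · rfl
    · intro p hp
      have := hout p hp
      rw [v1]
      split_ifs <;> omega
    any_goals simp [v1]
    any_goals omega
    rw [← not_lt, len_mul_simple_lt_iff x i1, show w + 1 - 1 = w from rfl]
    omega

theorem maskSum_rows_one {k m : ℕ} (hk : 1 ≤ k) (hm : k + m + 1 < n) :
    maskSum (n := n) (rows k m) 1 1 = stateSum m 0 1 2 :=
  maskSum_rows_eq_stateSum (w := k + m - 1) hk hm (by omega) (fun p _ => val_one p)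
    (val_one _) (val_one _) (val_one _)

theorem stateSum_012 (m : ℕ) : stateSum (m + 1) 0 1 2 =
    stateSum m 0 1 2 + stateSum m 0 2 1 + stateSum m 1 0 2 + stateSum m 1 2 0 := by
  simp [stateSum, stateStep]
  ring

theorem stateSum_021 (m : ℕ) : stateSum (m + 1) 0 2 1 =
    X * (stateSum m 0 1 2 + stateSum m 1 0 2) := by
  simp [stateSum, stateStep]
  ring

theorem stateSum_102 (m : ℕ) : stateSum (m + 1) 1 0 2 =
    X * (stateSum m 0 1 2 + stateSum m 0 2 1) + stateSum m 2 0 1 + stateSum m 2 1 0 := by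
  simp [stateSum, stateStep]
  ring

theorem stateSum_120 (m : ℕ) : stateSum (m + 1) 1 2 0 =
    X * (stateSum m 0 2 1 + stateSum m 2 0 1) := by
  simp [stateSum, stateStep]
  ring

theorem stateSum_201 (m : ℕ) : stateSum (m + 1) 2 0 1 = X ^ 2 * stateSum m 0 1 2 := by
  simp [stateSum, stateStep]
  ring

theorem stateSum_210 (m : ℕ) : stateSum (m + 1) 2 1 0 = X ^ 2 * stateSum m 0 2 1 := by
  simp [stateSum, stateStep]
  ring

/-- The generating function of the sums over masks for a given window state. -/
noncomputable def stateGen (a b c : ℕ) : PowerSeries ℤ[X] :=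
  PowerSeries.mk fun m => stateSum m a b c

theorem stateGen_eq {a b c : ℕ} {g : PowerSeries ℤ[X]}
    (h : ∀ m, stateSum (m + 1) a b c = PowerSeries.coeff m g) :
    stateGen a b c = PowerSeries.C (stateSum 0 a b c) + PowerSeries.X * g := by
  ext1 m
  cases m with
  | zero => simp [stateGen]
  | succ m => simp [stateGen, h, PowerSeries.coeff_succ_X_mul]

theorem stateGen_mul_genDen : stateGen 0 1 2 * genDen = genNum := by
  have e0 := stateGen_eq (a := 0) (b := 1) (c := 2)
    (g := stateGen 0 1 2 + stateGen 0 2 1 + stateGen 1 0 2 + stateGen 1 2 0)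
    (by simp [stateGen, stateSum_012])
  have e1 := stateGen_eq (a := 0) (b := 2) (c := 1)
    (g := PowerSeries.C X * (stateGen 0 1 2 + stateGen 1 0 2))
    (by simp [stateGen, stateSum_021, PowerSeries.coeff_C_mul])
  have e2 := stateGen_eq (a := 1) (b := 0) (c := 2)
    (g := PowerSeries.C X * (stateGen 0 1 2 + stateGen 0 2 1) + stateGen 2 0 1 + stateGen 2 1 0)
    (by simp [stateGen, stateSum_102, PowerSeries.coeff_C_mul])
  have e3 := stateGen_eq (a := 1) (b := 2) (c := 0)
    (g := PowerSeries.C X * (stateGen 0 2 1 + stateGen 2 0 1))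
    (by simp [stateGen, stateSum_120, PowerSeries.coeff_C_mul])
  have e4 := stateGen_eq (a := 2) (b := 0) (c := 1)
    (g := PowerSeries.C (X ^ 2) * stateGen 0 1 2)
    (by simp [stateGen, stateSum_201, PowerSeries.coeff_C_mul, -map_pow])
  have e5 := stateGen_eq (a := 2) (b := 1) (c := 0)
    (g := PowerSeries.C (X ^ 2) * stateGen 0 2 1)
    (by simp [stateGen, stateSum_210, PowerSeries.coeff_C_mul, -map_pow])
  simp [stateSum] at e0 e1 e2 e3 e4 e5
  rw [genDen, genNum]
  set y : PowerSeries ℤ[X] := PowerSeries.C X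
  set z : PowerSeries ℤ[X] := PowerSeries.X
  -- The multipliers form a row vector that eliminates the other five generating functions from the
  -- linear system. Only `e0` has a nonzero constant term, so its multiplier is the numerator.
  linear_combination (-1 + z ^ 2 * y ^ 2 + z ^ 3 * y ^ 3) * e0 -
    (z + 2 * z ^ 2 * y + z ^ 3 * y ^ 2) * e1 - (z + z ^ 2 * y + z ^ 3 * y ^ 2) * e2 -
    (z - z ^ 3 * y ^ 2 - z ^ 4 * y ^ 3) * e3 -
    (z ^ 2 + z ^ 2 * y + z ^ 3 * y + z ^ 4 * y ^ 2 - z ^ 4 * y ^ 3 - z ^ 5 * y ^ 4) * e4 -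
    (z ^ 2 + z ^ 3 * y + z ^ 4 * y ^ 2) * e5

theorem stateGen_eq_genFun : stateGen 0 1 2 = genFun := by
  have hden : genDen ≠ 0 := by
    intro h
    have := congrArg PowerSeries.constantCoeff h
    simp [genDen] at this
  exact mul_right_cancel₀ hden (stateGen_mul_genDen.trans genFun_mul_genDen.symm)

theorem maskSum_rows_eq_coeff {k m : ℕ} (hk : 1 ≤ k) (hm : k + m + 1 < n) :
    maskSum (n := n) (rows k m) 1 1 = PowerSeries.coeff m genFun := by
  rw [maskSum_rows_one hk hm, ← stateGen_eq_genFun, stateGen, PowerSeries.coeff_mk]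

end Transfer

/-! ### Two identities in an algebra over a field -/

section Algebra

variable {K A : Type*} [Field K] [Ring A] [Algebra K A]

theorem one_add_inv_smul_sub {q : K} (hq : q ≠ 0) (t : A) :
    1 + q⁻¹ • (t - (q - 1) • (1 : A)) = q⁻¹ • (1 + t) := by
  rw [smul_sub, smul_smul, mul_sub, inv_mul_cancel₀ hq]
  module

theorem add_smul_mul_sub_eq {c q : K} {r u t v : A} (huv : u * t = v) :
    (r + c • u) * (q⁻¹ • (t - (q - 1) • (1 : A))) - (c * q⁻¹) • v =
      q⁻¹ • (r * t) + (-(q⁻¹ * (q - 1))) • r + (-(q⁻¹ * (q - 1) * c)) • u := by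
  rw [mul_smul_comm, mul_sub, add_mul, smul_mul_assoc, huv, mul_smul_comm, mul_one]
  module

end Algebra

/-! ### Right multiplication and inverses in the Hecke algebra -/

section RightMultiplication

variable {K : Type*} [Field K] {q : K} {n : ℕ}

/-- On the vector of the identity, `T_s` and the right operator agree, and the right operator
commutes with every element of the algebra. -/
theorem evalOne_mul_T_simple {i : ℕ} (hi : 1 ≤ i ∧ i < n) (h : Hecke q n) :
    evalOne q n (h * T q (simple n i)) = rightOp q n i (evalOne q n h) := by
  have e : evalOne q n (T q (simple n i)) =
      rightOp q n i (Finsupp.single (1 : Equiv.Perm (Fin n)) 1) := by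
    have := len_mul_simple (1 : Equiv.Perm (Fin n)) hi
    rw [one_mul, len_one] at this
    rw [evalOne_T, rightOp_single, one_mul, if_pos]
    rw [len_one]
    omega
  have h1 : evalOne q n (h * T q (simple n i)) = h.1 (evalOne q n (T q (simple n i))) := rfl
  rw [h1, e]
  exact congrArg (fun f => f (Finsupp.single (1 : Equiv.Perm (Fin n)) 1))
    (hecke_comm_rightOp h hi).eq

theorem T_mul_simple {i : ℕ} (hi : 1 ≤ i ∧ i < n) (w : Equiv.Perm (Fin n))
    (h : len w < len (w * simple n i)) : T q w * T q (simple n i) = T q (w * simple n i) := by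
  apply evalOne_injective
  rw [evalOne_mul_T_simple hi, evalOne_T, evalOne_T, rightOp_single, if_pos h]

theorem T_mul_simple' {i : ℕ} (hi : 1 ≤ i ∧ i < n) (w : Equiv.Perm (Fin n))
    (h : ¬ len w < len (w * simple n i)) :
    T q w * T q (simple n i) = (q - 1) • T q w + q • T q (w * simple n i) := by
  apply evalOne_injective
  rw [evalOne_mul_T_simple hi, evalOne_T, rightOp_single, if_neg h, map_add, map_smul, map_smul,
    evalOne_T, evalOne_T]
  simp

theorem T_mul_one_add_simple {i : ℕ} (hi : 1 ≤ i ∧ i < n) (w : Equiv.Perm (Fin n)) :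
    T q w * (1 + T q (simple n i)) =
      (if len (w * simple n i) < len w then q else 1) • (T q w + T q (w * simple n i)) := by
  rw [mul_add, mul_one]
  have := len_mul_simple w hi
  split_ifs with h
  · rw [T_mul_simple' hi w (by omega)]
    module
  · rw [T_mul_simple hi w (by omega), one_smul]

/-- The product of the `1 + T_s` along a word. -/
noncomputable def genProd (q : K) (n : ℕ) (a : List ℕ) : Hecke q n :=
  (a.map fun i => 1 + T q (simple n i)).prod

theorem T_mul_genProd {a : List ℕ} (ha : IsExpression n a) (x : Equiv.Perm (Fin n)) :
    T q x * genProd q n a =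
      ∑ y, (maskSum a x y).eval₂ (Int.castRingHom K) q • T q y := by
  induction a generalizing x with
  | nil =>
    rw [Finset.sum_eq_single x]
    · simp [genProd, maskSum]
    · intro y _ hy
      simp [maskSum, hy.symm]
    · simp
  | cons i a ih =>
    have ih' := ih fun j hj => ha j (by simp [hj])
    have e : genProd q n (i :: a) = (1 + T q (simple n i)) * genProd q n a := by simp [genProd]
    rw [e, ← mul_assoc, T_mul_one_add_simple (ha i (by simp)), smul_mul_assoc, add_mul, ih', ih',
      ← Finset.sum_add_distrib, Finset.smul_sum]
    refine Finset.sum_congr rfl fun y _ => ?_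
    rw [maskSum_cons, Polynomial.eval₂_mul, Polynomial.eval₂_add, ← add_smul, smul_smul]
    congr 2
    split_ifs <;> simp

theorem T_simple_mul_inverse (hq : q ≠ 0) {i : ℕ} (hi : 1 ≤ i ∧ i < n) :
    Ring.inverse (T q (simple n i)) = q⁻¹ • (T q (simple n i) - (q - 1) • 1) := by
  have h := T_simple_mul_self (q := q) hi
  rw [T_one] at h
  have e : T q (simple n i) * (q⁻¹ • (T q (simple n i) - (q - 1) • 1)) = 1 := by
    rw [mul_smul_comm, mul_sub, h, mul_smul_comm, mul_one, add_sub_cancel_left, smul_smul,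
      inv_mul_cancel₀ hq, one_smul]
  have h2 := Ring.inverse_mul_cancel _ (isUnit_T hq (simple n i))
  calc Ring.inverse (T q (simple n i))
      = Ring.inverse (T q (simple n i)) *
        (T q (simple n i) * (q⁻¹ • (T q (simple n i) - (q - 1) • 1))) := by rw [e, mul_one]
    _ = _ := by rw [← mul_assoc, h2, one_mul]

theorem one_add_inverse_T_simple (hq : q ≠ 0) {i : ℕ} (hi : 1 ≤ i ∧ i < n) :
    1 + Ring.inverse (T q (simple n i)) = q⁻¹ • (1 + T q (simple n i)) := by
  rw [T_simple_mul_inverse hq hi]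
  exact one_add_inv_smul_sub hq _

/-- `(T_{(us)⁻¹})⁻¹ = (T_{u⁻¹})⁻¹ (T_s)⁻¹` if `l(us) > l(u)`. -/
theorem inverse_T_mul_simple (hq : q ≠ 0) {i : ℕ} (hi : 1 ≤ i ∧ i < n) (u : Equiv.Perm (Fin n))
    (h : len u < len (u * simple n i)) :
    Ring.inverse (T q (u * simple n i)⁻¹) =
      Ring.inverse (T q u⁻¹) * Ring.inverse (T q (simple n i)) := by
  have h1 : (u * simple n i)⁻¹ = simple n i * u⁻¹ := by rw [mul_inv_rev, simple_inv]
  have h2 : len u⁻¹ < len (simple n i * u⁻¹) := by rwa [← h1, len_inv, len_inv]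
  rw [h1, ← T_simple_mul hi _ h2]
  obtain ⟨a, ha⟩ := isUnit_T hq (simple n i)
  obtain ⟨b, hb⟩ := isUnit_T hq u⁻¹
  rw [← ha, ← hb, ← Units.val_mul, Ring.inverse_unit, Ring.inverse_unit, Ring.inverse_unit,
    mul_inv_rev, Units.val_mul]

theorem mem_span_mul_simple {i : ℕ} (hi : 1 ≤ i ∧ i < n) {r : ℕ} {h : Hecke q n}
    (hh : h ∈ Submodule.span K {t | ∃ z : Equiv.Perm (Fin n), len z < r ∧ t = T q z}) :
    h * T q (simple n i) ∈
      Submodule.span K {t | ∃ z : Equiv.Perm (Fin n), len z < r + 1 ∧ t = T q z} := by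
  induction hh using Submodule.span_induction with
  | mem t ht =>
    obtain ⟨z, hz, rfl⟩ := ht
    have hl := len_mul_simple z hi
    have m1 : T q z ∈ Submodule.span K
        {t | ∃ z : Equiv.Perm (Fin n), len z < r + 1 ∧ t = T q z} :=
      Submodule.subset_span ⟨z, by omega, rfl⟩
    have m2 : T q (z * simple n i) ∈ Submodule.span K
        {t | ∃ z : Equiv.Perm (Fin n), len z < r + 1 ∧ t = T q z} :=
      Submodule.subset_span ⟨_, by omega, rfl⟩
    by_cases h : len z < len (z * simple n i)
    · rwa [T_mul_simple hi z h]
    · rw [T_mul_simple' hi z h]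
      exact add_mem (Submodule.smul_mem _ _ m1) (Submodule.smul_mem _ _ m2)
  | zero => rw [zero_mul]; exact zero_mem _
  | add a b _ _ ha hb => rw [add_mul]; exact add_mem ha hb
  | smul c a _ ha => rw [smul_mul_assoc]; exact Submodule.smul_mem _ _ ha

/-- Unitriangularity of the involution: `(T_{w⁻¹})⁻¹ = q^{-l(w)} T_w` up to shorter terms. -/
theorem inverse_T_sub_mem_span (hq : q ≠ 0) (w : Equiv.Perm (Fin n)) :
    Ring.inverse (T q w⁻¹) - (q ^ len w)⁻¹ • T q w ∈
      Submodule.span K {t | ∃ z : Equiv.Perm (Fin n), len z < len w ∧ t = T q z} := by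
  obtain ⟨a, ha⟩ := exists_reduced w
  induction a using List.reverseRecOn generalizing w with
  | nil =>
    obtain ⟨-, h2, -⟩ := ha
    have : w = 1 := h2.symm
    subst this
    rw [len_one, pow_zero, inv_one, T_one, Ring.inverse_one, inv_one, one_smul, sub_self]
    exact zero_mem _
  | append_singleton a i ih =>
    obtain ⟨h1, rfl, h3⟩ := ha
    have hi := h1 i (by simp)
    have ha' : IsExpression n a := fun j hj => h1 j (by simp [hj])
    have h4 := len_wordProd_le ha'
    rw [wordProd_concat] at h3 ⊢
    rw [List.length_append, List.length_singleton] at h3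
    set u := wordProd n a
    have h5 := len_mul_simple u hi
    have hlt : len u < len (u * simple n i) := by omega
    have hlen : len (u * simple n i) = len u + 1 := by omega
    have hu := ih u ⟨ha', rfl, by omega⟩
    rw [inverse_T_mul_simple hq hi u hlt, T_simple_mul_inverse hq hi, hlen]
    have hlow : ∀ {h : Hecke q n},
        h ∈ Submodule.span K {t | ∃ z : Equiv.Perm (Fin n), len z < len u ∧ t = T q z} →
        h ∈ Submodule.span K {t | ∃ z : Equiv.Perm (Fin n), len z < len u + 1 ∧ t = T q z} :=
      fun h => Submodule.span_mono (by rintro t ⟨z, hz, rfl⟩; exact ⟨z, by omega, rfl⟩) h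
    have hTu : T q u ∈ Submodule.span K
        {t | ∃ z : Equiv.Perm (Fin n), len z < len u + 1 ∧ t = T q z} :=
      Submodule.subset_span ⟨u, by omega, rfl⟩
    obtain ⟨r, hr⟩ : ∃ r, r = Ring.inverse (T q u⁻¹) - (q ^ len u)⁻¹ • T q u := ⟨_, rfl⟩
    rw [← hr] at hu
    have e1 : Ring.inverse (T q u⁻¹) = r + (q ^ len u)⁻¹ • T q u := by rw [hr, sub_add_cancel]
    -- Here `r` is the shorter part of the inverse for `u`. Besides the leading term `T_{us}`, the
    -- product yields only `r T_s`, `r` and `T_u`, all in lengths below `l(us)`.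
    have e := add_smul_mul_sub_eq (c := (q ^ len u)⁻¹) (q := q) (r := r) (T_mul_simple hi u hlt)
    rw [e1, pow_succ, mul_inv, e]
    exact add_mem (add_mem (Submodule.smul_mem _ _ (mem_span_mul_simple hi hu))
      (Submodule.smul_mem _ _ (hlow hu))) (Submodule.smul_mem _ _ hTu)

theorem repr_T (w z : Equiv.Perm (Fin n)) :
    (heckeBasis q n).repr (T q w) z = if w = z then 1 else 0 := by
  rw [T, Module.Basis.repr_self, Finsupp.single_apply]

theorem repr_inverse_T (hq : q ≠ 0) {w z : Equiv.Perm (Fin n)} (h : len w ≤ len z) :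
    (heckeBasis q n).repr (Ring.inverse (T q w⁻¹)) z = if w = z then (q ^ len w)⁻¹ else 0 := by
  have hspan : ∀ t ∈ Submodule.span K {t | ∃ z : Equiv.Perm (Fin n), len z < len w ∧ t = T q z},
      (heckeBasis q n).repr t z = 0 := by
    intro t ht
    induction ht using Submodule.span_induction with
    | mem t ht =>
      obtain ⟨u, hu, rfl⟩ := ht
      rw [repr_T, if_neg]
      rintro rfl
      omega
    | zero => simp
    | add a b _ _ ha hb => simp [ha, hb]
    | smul c a _ ha => simp [ha]
  have := hspan _ (inverse_T_sub_mem_span hq w)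
  rw [map_sub, Finsupp.sub_apply, sub_eq_zero, map_smul, Finsupp.smul_apply, repr_T] at this
  rw [this]
  simp

end RightMultiplication

/-! ### The involution on products of `1 + T_s` -/

section Involution

variable {n : ℕ}

theorem iota_add (h h' : Hecke q n) : iota (h + h') = iota h + iota h' := by
  simp only [iota, map_add, Finsupp.add_apply, add_smul, Finset.sum_add_distrib]

theorem iota_smul (c : CoeffField) (h : Hecke q n) : iota (c • h) = bar c • iota h := by
  simp only [iota, map_smul, Finsupp.smul_apply, smul_eq_mul, map_mul, mul_smul, Finset.smul_sum]

theorem iota_T (w : Equiv.Perm (Fin n)) : iota (T q w) = Ring.inverse (T q w⁻¹) := by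
  rw [iota, Finset.sum_eq_single w]
  · simp [repr_T]
  · intro z _ hz
    simp [repr_T, hz.symm]
  · simp

theorem bar_q : bar q = q⁻¹ := by
  rw [q, map_pow, bar_sqrtQ, inv_pow]

theorem hecke_induction {p : Hecke q n → Prop} (hT : ∀ (w : Equiv.Perm (Fin n)) (c : CoeffField), p (c • T q w))
    (hadd : ∀ a b, p a → p b → p (a + b)) (h : Hecke q n) : p h := by
  rw [← (heckeBasis q n).sum_repr h]
  refine Finset.sum_induction _ p hadd ?_ fun w _ => hT w _
  have := hT 1 0
  rwa [zero_smul] at this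

/-- The source is `1 + T_s⁻¹ = q⁻¹ (1 + T_s)`. This case replaces full multiplicativity of the
involution. -/
theorem iota_mul_one_add_simple {i : ℕ} (hi : 1 ≤ i ∧ i < n) (h : Hecke q n) :
    iota (h * (1 + T q (simple n i))) = q⁻¹ • (iota h * (1 + T q (simple n i))) := by
  induction h using hecke_induction with
  | hadd a b ha hb => rw [add_mul, iota_add, ha, hb, iota_add, add_mul, smul_add]
  | hT w c =>
    rw [smul_mul_assoc, iota_smul, iota_smul, smul_mul_assoc, smul_comm q⁻¹]
    congr 1
    rw [T_mul_one_add_simple hi, iota_smul, iota_add, iota_T, iota_T]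
    have hl := len_mul_simple w hi
    have hinv := one_add_inverse_T_simple q_ne_zero hi
    split_ifs with h
    · have hw : w * simple n i * simple n i = w := by rw [mul_assoc, simple_mul_self, mul_one]
      have e := inverse_T_mul_simple q_ne_zero hi (w * simple n i) (by rw [hw]; exact h)
      rw [hw] at e
      rw [e, bar_q]
      congr 1
      rw [mul_assoc, mul_add, mul_one, Ring.inverse_mul_cancel _ (isUnit_T q_ne_zero _), mul_add,
        mul_one, add_comm]
    · rw [inverse_T_mul_simple q_ne_zero hi w (by omega), map_one, one_smul, ← mul_smul_comm,
        ← hinv, mul_add, mul_one]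

theorem iota_genProd {a : List ℕ} (ha : IsExpression n a) :
    iota (genProd q n a) = (q ^ a.length)⁻¹ • genProd q n a := by
  induction a using List.reverseRecOn with
  | nil =>
    have e : genProd q n [] = T q 1 := by simp [genProd, T_one]
    rw [e, iota_T, inv_one, T_one, Ring.inverse_one]
    simp
  | append_singleton a i ih =>
    have e : genProd q n (a ++ [i]) = genProd q n a * (1 + T q (simple n i)) := by simp [genProd]
    rw [e, iota_mul_one_add_simple (ha i (by simp)), ih fun j hj => ha j (by simp [hj]),
      smul_mul_assoc, smul_smul, List.length_append, List.length_singleton, pow_succ, mul_inv,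
      mul_comm]

end Involution

/-! ### Uniqueness of Kazhdan–Lusztig families -/

section Uniqueness

open Polynomial

variable {n : ℕ}

theorem BruhatLE.len_lt {x w : Equiv.Perm (Fin n)} (h : BruhatLE x w) (hne : x ≠ w) :
    len x < len w := by
  rcases Relation.ReflTransGen.cases_tail h with rfl | ⟨u, hu, t, -, -, hlt⟩
  · exact absurd rfl hne
  · exact lt_of_le_of_lt (BruhatLE.len_le hu) hlt

theorem repr_klElement {w : Equiv.Perm (Fin n)} {P : Equiv.Perm (Fin n) → ℚ[X]}
    (hP : ∀ x, ¬ BruhatLE x w → P x = 0) (z : Equiv.Perm (Fin n)) :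
    (heckeBasis q n).repr (klElement w P) z =
      (sqrtQ ^ len w)⁻¹ * (P z).eval₂ RatFunc.C q := by
  classical
  rw [klElement, map_smul, Finsupp.smul_apply, smul_eq_mul, map_sum, Finsupp.finsetSum_apply]
  congr 1
  simp only [map_smul, Finsupp.smul_apply, repr_T, smul_eq_mul, mul_ite, mul_one, mul_zero]
  rw [Finset.sum_ite_eq']
  split_ifs with h
  · rfl
  · rw [hP z (by simpa using h), eval₂_zero]

theorem repr_iota (h : Hecke q n) (z : Equiv.Perm (Fin n)) :
    (heckeBasis q n).repr (iota h) z = ∑ w, bar ((heckeBasis q n).repr h w) *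
      (heckeBasis q n).repr (Ring.inverse (T q w⁻¹)) z := by
  rw [iota, map_sum, Finsupp.finsetSum_apply]
  simp only [map_smul, Finsupp.smul_apply, smul_eq_mul]

/-- If two elements agree in lengths above `l(z)`, their images under the involution differ at `z`
by the conjugate of their difference at `z`, up to a power of `q`. -/
theorem repr_iota_sub {h h' : Hecke q n} {z : Equiv.Perm (Fin n)}
    (hh : ∀ u, len z < len u → (heckeBasis q n).repr h u = (heckeBasis q n).repr h' u) :
    (heckeBasis q n).repr (iota h) z - (heckeBasis q n).repr (iota h') z =
      bar ((heckeBasis q n).repr h z - (heckeBasis q n).repr h' z) * (q ^ len z)⁻¹ := by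
  rw [repr_iota, repr_iota, ← Finset.sum_sub_distrib, Finset.sum_eq_single z]
  · rw [repr_inverse_T q_ne_zero le_rfl, if_pos rfl, map_sub, sub_mul]
  · intro u _ hu
    -- Triangularity kills the terms with `u` no longer than `z`; for longer `u` the two elements
    -- agree.
    rcases le_or_gt (len u) (len z) with hl | hl
    · rw [repr_inverse_T q_ne_zero hl, if_neg hu, mul_zero, mul_zero, sub_zero]
    · rw [hh u hl, sub_self]
  · simp

theorem eval₂_q_injective :
    Function.Injective (Polynomial.eval₂ (RatFunc.C (K := ℚ)) q) := by
  have h : Transcendental ℚ q := by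
    have hs : Transcendental ℚ sqrtQ := fun h =>
      RatFunc.transcendental_X (K := ℚ) (by convert h using 1; exacts [Subsingleton.elim _ _, rfl])
    exact hs.pow two_pos
  have e : algebraMap ℚ CoeffField = RatFunc.C := Subsingleton.elim _ _
  intro a b hab
  apply transcendental_iff_injective.mp h
  simpa [Polynomial.aeval_def, e] using hab

theorem bar_eval₂ (p : ℚ[X]) : bar (p.eval₂ RatFunc.C q) = p.eval₂ RatFunc.C q⁻¹ := by
  rw [Polynomial.hom_eval₂, bar_q]
  congr 1
  exact Subsingleton.elim _ _

/-- A polynomial in `q` of small degree cannot be self-dual with a large shift. -/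
theorem eq_zero_of_selfDual {p : ℚ[X]} {L r : ℕ} (hdeg : 2 * p.natDegree + r + 1 ≤ L)
    (h : q ^ L * p.eval₂ RatFunc.C q⁻¹ = q ^ r * p.eval₂ RatFunc.C q) : p = 0 := by
  obtain ⟨s, hs⟩ : ∃ s, L = s + p.natDegree := ⟨L - p.natDegree, by omega⟩
  -- The left side is divisible by `X ^ s`, while the right side has degree at most `r + p.natDegree
  -- < s`.
  have key : X ^ s * reflect p.natDegree p = X ^ r * p := by
    apply eval₂_q_injective
    rw [eval₂_mul, eval₂_mul, eval₂_X_pow, eval₂_X_pow, ← h, hs, pow_add, mul_assoc]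
    congr 1
    have hq := q_ne_zero
    let : Invertible (q⁻¹ : CoeffField) := invertibleOfNonzero (inv_ne_zero hq)
    have e := eval₂_reflect_mul_pow RatFunc.C (q⁻¹ : CoeffField) p.natDegree p le_rfl
    rw [invOf_eq_inv, inv_inv] at e
    rw [← e, mul_comm, mul_assoc, ← mul_pow, inv_mul_cancel₀ hq, one_pow, mul_one]
  ext d
  rw [coeff_zero]
  by_cases hd : d ≤ p.natDegree
  · have := congrArg (coeff · (d + r)) key
    simp only [coeff_X_pow_mul] at this
    rw [← this, coeff_X_pow_mul', if_neg (by omega)]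
  · exact coeff_eq_zero_of_natDegree_lt (by omega)

theorem IsKLFamily.unique {w : Equiv.Perm (Fin n)} {P P' : Equiv.Perm (Fin n) → ℚ[X]}
    (hP : IsKLFamily w P) (hP' : IsKLFamily w P') : P' = P := by
  suffices H : ∀ N z, len w - len z = N → P' z = P z from funext fun z => H _ z rfl
  intro N
  -- Downward induction on length: agreement above `l(z)` makes the difference at `z` self-dual with
  -- a shift too large for its degree.
  induction N using Nat.strong_induction_on with
  | _ N ih =>
    intro z hz
    by_cases hzw : z = w
    · rw [hzw, hP.self_eq, hP'.self_eq]
    by_cases hle : BruhatLE z w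
    swap
    · rw [hP.eq_zero z hle, hP'.eq_zero z hle]
    have hlt := hle.len_lt hzw
    have hagree : ∀ u, len z < len u → (heckeBasis q n).repr (klElement w P') u =
        (heckeBasis q n).repr (klElement w P) u := by
      intro u hu
      rw [repr_klElement hP.eq_zero, repr_klElement hP'.eq_zero, ih _ _ u rfl]
      omega
    have h := repr_iota_sub hagree
    rw [hP.iota_eq, hP'.iota_eq, repr_klElement hP.eq_zero, repr_klElement hP'.eq_zero, ← mul_sub,
      ← eval₂_sub, map_mul, bar_eval₂, map_inv₀, map_pow, bar_sqrtQ] at h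
    have h1 := hP.degree_le z hle hzw
    have h2 := hP'.degree_le z hle hzw
    have h3 := natDegree_sub_le (P' z) (P z)
    refine sub_eq_zero.mp (eq_zero_of_selfDual (L := len w) (r := len z) (by omega) ?_)
    have hs := sqrtQ_ne_zero
    have hq : q = sqrtQ ^ 2 := rfl
    have hL : (q : CoeffField) ^ len w = sqrtQ ^ len w * sqrtQ ^ len w := by
      rw [hq, ← pow_mul, ← pow_add]
      congr 1
      omega
    have hz0 : (q : CoeffField) ^ len z ≠ 0 := pow_ne_zero _ q_ne_zero
    have hw0 : sqrtQ ^ len w ≠ 0 := pow_ne_zero _ hs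
    rw [inv_pow, inv_inv] at h
    generalize eval₂ RatFunc.C q⁻¹ (P' z - P z) = A at *
    generalize eval₂ RatFunc.C q (P' z - P z) = B at *
    rw [hL]
    generalize (q : CoeffField) ^ len z = Z at *
    generalize sqrtQ ^ len w = S at *
    field_simp at h
    linear_combination -h

end Uniqueness

/-! ### Mask sums as Kazhdan–Lusztig polynomials -/

section Existence

open Polynomial

variable {n : ℕ}

/-- If the sums over the masks of a reduced expression satisfy the degree bounds, they are the
Kazhdan–Lusztig polynomials. -/
theorem isKLFamily_maskSum {a : List ℕ} (ha : IsReducedExpression a (wordProd n a))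
    (hself : maskSum a 1 (wordProd n a) = 1)
    (hdeg : ∀ y ≠ wordProd n a, ∀ d, (maskSum a 1 y).coeff d ≠ 0 →
      2 * d + len y + 1 ≤ len (wordProd n a)) :
    IsKLFamily (wordProd n a) fun y => (maskSum a 1 y).map (Int.castRingHom ℚ) := by
  have hzero : ∀ x, ¬ BruhatLE x (wordProd n a) →
      (maskSum a 1 x).map (Int.castRingHom ℚ) = 0 := by
    intro x hx
    have : maskSum a 1 x = 0 := by
      by_contra hc
      exact hx (bruhatLE_of_maskSum_ne_zero ha hc)
    rw [this, Polynomial.map_zero]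
  have hkl : klElement (wordProd n a) (fun y => (maskSum a 1 y).map (Int.castRingHom ℚ)) =
      (sqrtQ ^ len (wordProd n a))⁻¹ • genProd q n a := by
    classical
    have e := T_mul_genProd (q := q) ha.1 1
    rw [T_one, one_mul] at e
    rw [klElement, e]
    congr 1
    rw [Finset.sum_filter]
    refine Finset.sum_congr rfl fun x _ => ?_
    have e2 : ((maskSum a 1 x).map (Int.castRingHom ℚ)).eval₂ RatFunc.C q =
        (maskSum a 1 x).eval₂ (Int.castRingHom CoeffField) q := by
      rw [eval₂_map]
      congr 1
      exact Subsingleton.elim _ _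
    split_ifs with h
    · rw [e2]
    · rw [← e2, hzero x h, eval₂_zero, zero_smul]
  refine ⟨?_, ?_, ?_, hzero⟩
  · rw [hkl, iota_smul, iota_genProd ha.1, smul_smul, ha.2.2, map_inv₀, map_pow, bar_sqrtQ]
    congr 1
    have hw0 : sqrtQ ^ len (wordProd n a) ≠ 0 := pow_ne_zero _ sqrtQ_ne_zero
    rw [q, ← pow_mul, mul_comm 2, pow_mul, inv_pow, inv_inv]
    field_simp
  · simp only [hself, Polynomial.map_one]
  · intro x hx hne
    by_cases h0 : (maskSum a 1 x).map (Int.castRingHom ℚ) = 0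
    · simp only [h0, natDegree_zero]
      have := hx.len_lt hne
      omega
    · refine hdeg x hne _ fun hc => h0 ?_
      rw [← leadingCoeff_eq_zero, leadingCoeff, coeff_map, hc, map_zero]

end Existence

end KazhdanLusztig

/-! ### The theorem -/

theorem theorem4 (n k l : ℕ) (hk : 1 ≤ k) (hkl : k ≤ l) (hl : l + 2 < n)
    (v : Equiv.Perm (Fin n))
    (hv : v = KazhdanLusztig.wordProd n (KazhdanLusztig.diamondWord k l)) :
    KazhdanLusztig.IsReducedExpression (KazhdanLusztig.diamondWord k l) v ∧
      ∃ P : Equiv.Perm (Fin n) → Polynomial ℚ,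
        KazhdanLusztig.IsKLFamily v P ∧
        (∀ P' : Equiv.Perm (Fin n) → Polynomial ℚ, KazhdanLusztig.IsKLFamily v P' → P' = P) ∧
        P 1 = (PowerSeries.coeff (l - k + 1) KazhdanLusztig.genFun).map (Int.castRingHom ℚ) := by
  obtain ⟨m, hm⟩ : ∃ m, m = l + 1 - k := ⟨_, rfl⟩
  rw [KazhdanLusztig.diamondWord_eq_rows (by omega), ← hm] at hv ⊢
  have hmn : k + m + 1 < n := by omega
  -- Masks start from the identity, whose window is increasing.
  obtain ⟨h1, h2, h3⟩ := KazhdanLusztig.maskSum_rows_of_increasing (w := k + m - 1) (x := 1) hk hmn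
    (by omega) (fun p _ => KazhdanLusztig.val_one p) (by simp [KazhdanLusztig.val_one])
    (by simp [KazhdanLusztig.val_one])
  rw [one_mul] at h1 h2
  simp only [one_mul] at h3
  rw [KazhdanLusztig.len_one] at h1 h3
  have hred : KazhdanLusztig.IsReducedExpression (KazhdanLusztig.rows k m)
      (KazhdanLusztig.wordProd n (KazhdanLusztig.rows k m)) :=
    ⟨KazhdanLusztig.isExpression_rows hk hmn, rfl, by
      rw [KazhdanLusztig.length_rows, h1, zero_add]⟩
  have hkl := KazhdanLusztig.isKLFamily_maskSum hred h2 fun y hy d hd => by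
    have := h3 y hy d hd
    omega
  subst hv
  refine ⟨hred, _, hkl, fun P' hP' => hkl.unique hP', ?_⟩
  rw [show l - k + 1 = m by omega]
  simp only [KazhdanLusztig.maskSum_rows_eq_coeff hk hmn]
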